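/- Let $K$ be a field and let $(\mathcal H,*,\Delta,1,c)$ be a (unital, counital) bialgebra over $K$. Definitions. $\mathrm{Prim}\,\mathcal H=\{x:\Delta(x)=x\otimes 1+1\otimes x\}$. Put $F_0=K1$ and let $F_r$ be the space of all $x\in\mathcal H$ with $\Delta(x)-x\otimes 1-1\otimes x\in F_{r-1}\otimes F_{r-1}$; $\mathcal H$ is connected if $\mathcal H=\bigcup_r F_r$. The tensor coalgebra $T^c(V)$ is $\bigoplus_{n\ge 0}V^{\otimes n}$ with the deconcatenation coproduct; $\mathcal H$ is cofree (among connected coalgebras) if $\mathcal H\cong T^c(\mathrm{Prim}\,\mathcal H)$ as coalgebras. A 2-associative algebra is a vector space with two associative products $*$ and $\cdot$ that have the same unit. A 2-associative bialgebra is a 2-associative algebra with a coproduct $\Delta$ such that $(*,\Delta)$ is a bialgebra structure and $\Delta(x\cdot y)=(x\otimes 1)\cdot\Delta(y)+\Delta(x)\cdot(1\otimes y)-x\otimes y$. A $B_\infty$-algebra is a vector space $R$ with linear maps $M_{pq}:R^{\otimes p}\otimes R^{\otimes q}\to R$ $(p,q\ge 0)$ such that $M_{00}=0$, $M_{10}=M_{01}=\mathrm{Id}$,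 $M_{n0}=M_{0n}=0$ for $n\ge 2$, and for all words $u,v,w$ of positive lengths $$\sum M_{l|w|}\bigl(M(u^{(1)},v^{(1)})\cdots M(u^{(l)},v^{(l)}),\,w\bigr)=\sum M_{|u|m}\bigl(u,\,M(v^{(1)},w^{(1)})\cdots M(v^{(m)},w^{(m)})\bigr),$$ where the sums run over all ways to cut $(u,v)$ into $l\ge 1$, respectively $(v,w)$ into $m\ge 1$, consecutive pairs of blocks, in which one block of a pair, but not both, may be empty. On every 2-associative algebra operations $M_{pq}$ are defined inductively by the above values for $p=0$ or $q=0$ and, for $p,q\ge 1$, by $$M_{pq}(u_1\cdots u_p,v_1\cdots v_q)=(u_1\cdot\ldots\cdot u_p)*(v_1\cdot\ldots\cdot v_q)-\sum_{k\ge 2}\sum M(u^{(1)},v^{(1)})\cdot\ldots\cdot M(u^{(k)},v^{(k)}),$$ where the inner sum runs over the cuttings of $(u_1\cdots u_p,v_1\cdots v_q)$ into $k$ pairs of blocks. For a $B_\infty$-algebra $R$, $U2(R)$ is the quotient of the free 2-associative algebra $2as(R)$ on the vector space $R$ by the ideal (for both products) generated by the differences between $M_{pq}(r_1\cdots r_p,s_1\cdots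 s_q)$ computed in $R$ and in $2as(R)$. When $\mathcal H$ is a 2-associative bialgebra, $\mathrm{Prim}\,\mathcal H$ is regarded as a sub-$B_\infty$-algebra of $\mathcal H$, and $U2(\mathrm{Prim}\,\mathcal H)$ carries the unique coproduct that makes it a 2-associative bialgebra in which the elements of $\mathrm{Prim}\,\mathcal H$ are primitive. Theorem. The following are equivalent: (a) $\mathcal H$ is connected and has a second product $\cdot$ for which $(\mathcal H,*,\cdot,\Delta)$ is a 2-associative bialgebra; (b) $\mathcal H$ has a second product $\cdot$ for which $(\mathcal H,*,\cdot,\Delta)$ is a 2-associative bialgebra, and $\mathcal H\cong U2(\mathrm{Prim}\,\mathcal H)$ as 2-associative bialgebras, with the $B_\infty$-structure on $\mathrm{Prim}\,\mathcal H$ (including its existence) coming from this product and with the above coproduct on $U2(\mathrm{Prim}\,\mathcal H)$ (including its existence); (c) $\mathcal H$ is cofree, i.e. $\mathcal H\cong T^c(\mathrm{Prim}\,\mathcal H)$ as a coalgebra. Moreover, for every given second product $\cdot$ for which $(\mathcal H,*,\cdot,\Delta)$ is a 2-associative bialgebra, the following are equivalent: $\mathcal H$ is connected; $\mathcal H\cong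 U2(\mathrm{Prim}\,\mathcal H)$ as 2-associative bialgebras, for this product, in the sense of (b); $\mathcal H$ is cofree. -/

import Mathlib

open scoped TensorProduct

namespace LodayRonco

section Coalgebra

variable (K A : Type*) [CommRing K] [Ring A] [Algebra K A] [Coalgebra K A]

/-- The reduced coproduct `x ↦ Δ x - x ⊗ 1 - 1 ⊗ x`. -/
def reducedComul : A →ₗ[K] A ⊗[K] A :=
  Coalgebra.comul - (TensorProduct.mk K A A).flip 1 - TensorProduct.mk K A A 1

/-- The space `Prim A` of primitive elements, i.e. those with `Δ x = x ⊗ 1 + 1 ⊗ x`. -/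
def Prim : Submodule K A where
  carrier := {x | Coalgebra.comul (R := K) x = x ⊗ₜ[K] (1 : A) + (1 : A) ⊗ₜ[K] x}
  add_mem' := by
    intro x y hx hy
    simp only [Set.mem_ofPred_eq] at *
    rw [map_add, hx, hy, TensorProduct.add_tmul, TensorProduct.tmul_add]
    abel
  zero_mem' := by simp
  smul_mem' := by
    intro c x hx
    simp only [Set.mem_ofPred_eq] at *
    rw [map_smul, hx, smul_add, TensorProduct.smul_tmul', TensorProduct.tmul_smul]

/-- The coradical filtration: `F 0 = K 1`, and `F (r + 1)` consists of the elements whose reduced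
coproduct lies in (the image in `A ⊗ A` of) `F r ⊗ F r`. The reduced coproduct is applied to all of
`A`, not only to the augmentation ideal; since `1` is sent to `-1 ⊗ 1`, this gives `K 1` plus the
elements of the augmentation ideal that satisfy the condition. -/
def coradicalFiltration : ℕ → Submodule K A
  | 0 => Submodule.span K {1}
  | r + 1 => (LinearMap.range (TensorProduct.mapIncl
      (coradicalFiltration r) (coradicalFiltration r))).comap (reducedComul K A)

/-- Connectedness: the coradical filtration is exhaustive. -/
def IsConnected : Prop := ∀ x : A, ∃ r, x ∈ coradicalFiltration K A r

end Coalgebra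

section TensorCoalgebra

variable (K V : Type*) [CommRing K] [AddCommGroup V] [Module K V]

/-- The tensor module `K ⊕ V ⊕ V^{⊗2} ⊕ ⋯`, to be equipped below with deconcatenation. -/
abbrev TensorCoalgebra : Type _ := TensorAlgebra K V

namespace TensorCoalgebra

/-- The word `v₁ ⋯ vₙ`, an element of the summand `V^{⊗n}`. -/
noncomputable def word (l : List V) : TensorCoalgebra K V :=
  (l.map (TensorAlgebra.ι K)).prod

/-- For `v` in `V`, the endomorphism `(x, t) ↦ (v x, 1 ⊗ v x + (v ⊗ 1) t)` of `T ⊕ (T ⊗ T)`. -/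
noncomputable def step : V →ₗ[K]
    Module.End K (TensorAlgebra K V × (TensorAlgebra K V ⊗[K] TensorAlgebra K V)) where
  toFun v := LinearMap.prod
    (LinearMap.mulLeft K (TensorAlgebra.ι K v) ∘ₗ LinearMap.fst K _ _)
    (TensorProduct.mk K _ _ 1 ∘ₗ LinearMap.mulLeft K (TensorAlgebra.ι K v) ∘ₗ LinearMap.fst K _ _
      + (LinearMap.mulLeft K (TensorAlgebra.ι K v)).rTensor _ ∘ₗ LinearMap.snd K _ _)
  map_add' v w := by
    ext x <;>
      simp [add_mul, TensorProduct.tmul_add, TensorProduct.add_tmul]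
  map_smul' c v := by
    ext x <;>
      simp [TensorProduct.smul_tmul']

/-- Deconcatenation, determined by `Δ 1 = 1 ⊗ 1` and `Δ (v x) = 1 ⊗ v x + (v ⊗ 1) Δ x`; the closed
formula on words is `comul_word` below. -/
noncomputable def deconcatenation :
    TensorAlgebra K V →ₗ[K] TensorAlgebra K V ⊗[K] TensorAlgebra K V :=
  LinearMap.snd K _ _ ∘ₗ LinearMap.applyₗ (1, 1 ⊗ₜ 1) ∘ₗ
    (TensorAlgebra.lift K (step K V)).toLinearMap

noncomputable instance : CoalgebraStruct K (TensorCoalgebra K V) where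
  comul := deconcatenation K V
  counit := (TensorAlgebra.algebraMapInv (R := K) (M := V)).toLinearMap

theorem step_apply (v : V) (y : TensorAlgebra K V × (TensorAlgebra K V ⊗[K] TensorAlgebra K V)) :
    step K V v y = (TensorAlgebra.ι K v * y.1, 1 ⊗ₜ (TensorAlgebra.ι K v * y.1) +
      (LinearMap.mulLeft K (TensorAlgebra.ι K v)).rTensor _ y.2) := rfl

theorem lift_step_fst (x : TensorAlgebra K V) :
    ∀ y, (TensorAlgebra.lift K (step K V) x y).1 = x * y.1 := by
  induction x using TensorAlgebra.induction with
  | algebraMap r => intro y; simp [Algebra.smul_def]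
  | ι v => intro y; simp [step]
  | mul a b ha hb => intro y; simp [ha, hb, mul_assoc]
  | add a b ha hb => intro y; simp [ha, hb, add_mul]

theorem deconcatenation_one : deconcatenation K V 1 = 1 ⊗ₜ 1 := by
  simp [deconcatenation]

theorem deconcatenation_ι_mul (v : V) (x : TensorAlgebra K V) :
    deconcatenation K V (TensorAlgebra.ι K v * x) = 1 ⊗ₜ (TensorAlgebra.ι K v * x)
      + (LinearMap.mulLeft K (TensorAlgebra.ι K v)).rTensor _ (deconcatenation K V x) := by
  have h : ∀ y, TensorAlgebra.lift K (step K V) (TensorAlgebra.ι K v) y = step K V v y := by simp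
  simp only [deconcatenation, LinearMap.comp_apply, AlgHom.toLinearMap_apply, map_mul,
    LinearMap.applyₗ_apply_apply, Module.End.mul_apply, h, step_apply, LinearMap.snd_apply, lift_step_fst, mul_one]

theorem comul_word (l : List V) :
    CoalgebraStruct.comul (R := K) (word K V l) =
      ∑ i ∈ Finset.range (l.length + 1), word K V (l.take i) ⊗ₜ[K] word K V (l.drop i) := by
  change deconcatenation K V (l.map (TensorAlgebra.ι K)).prod = _
  induction l with
  | nil => exact (deconcatenation_one K V).trans (by simp [word])
  | cons v l ih =>
    rw [List.map_cons, List.prod_cons, deconcatenation_ι_mul, ih, List.length_cons,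
      Finset.sum_range_succ' _ (l.length + 1), map_sum, add_comm]
    simp [word]

theorem counit_word (l : List V) :
    CoalgebraStruct.counit (R := K) (word K V l) = if l = [] then 1 else 0 := by
  change TensorAlgebra.algebraMapInv (l.map (TensorAlgebra.ι K)).prod = _
  cases l with
  | nil => simp
  | cons v l => simp [TensorAlgebra.algebraMapInv]

/-- Induction on words: multiply by one letter on the left. -/
theorem induction_left {C : TensorAlgebra K V → Prop} (h1 : C 1)
    (hsmul : ∀ (c : K) x, C x → C (c • x)) (hadd : ∀ x y, C x → C y → C (x + y))
    (hmul : ∀ v x, C x → C (TensorAlgebra.ι K v * x)) (x : TensorAlgebra K V) : C x := by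
  suffices h : ∀ x : TensorAlgebra K V, ∀ y, C y → C (x * y) by simpa using h x 1 h1
  intro x
  induction x using TensorAlgebra.induction with
  | algebraMap r => intro y hy; rw [← Algebra.smul_def]; exact hsmul r y hy
  | ι v => intro y hy; exact hmul v y hy
  | mul a b ha hb => intro y hy; rw [mul_assoc]; exact ha _ (hb _ hy)
  | add a b ha hb => intro y hy; rw [add_mul]; exact hadd _ _ (ha _ hy) (hb _ hy)

theorem deconcatenation_coassoc (x : TensorAlgebra K V) :
    TensorProduct.assoc K _ _ _ ((deconcatenation K V).rTensor _ (deconcatenation K V x)) =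
      (deconcatenation K V).lTensor _ (deconcatenation K V x) := by
  induction x using induction_left with
  | h1 => simp [deconcatenation_one]
  | hsmul c x hx => simp only [map_smul, hx]
  | hadd x y hx hy => simp only [map_add, hx, hy]
  | hmul v x hx =>
    have h1 : ∀ t : TensorAlgebra K V ⊗[K] TensorAlgebra K V,
        TensorProduct.assoc K _ _ _ ((deconcatenation K V).rTensor _
          ((LinearMap.mulLeft K (TensorAlgebra.ι K v)).rTensor _ t)) =
        1 ⊗ₜ (LinearMap.mulLeft K (TensorAlgebra.ι K v)).rTensor _ t +
        (LinearMap.mulLeft K (TensorAlgebra.ι K v)).rTensor _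
          (TensorProduct.assoc K _ _ _ ((deconcatenation K V).rTensor _ t)) := by
      intro t
      induction t using TensorProduct.induction_on with
      | zero => simp
      | add s t hs ht => simp only [map_add, hs, ht, TensorProduct.tmul_add]; abel
      | tmul a b =>
        simp only [LinearMap.rTensor_tmul, LinearMap.mulLeft_apply, deconcatenation_ι_mul,
          TensorProduct.add_tmul, map_add, TensorProduct.assoc_tmul]
        congr 1
        generalize deconcatenation K V a = u
        induction u using TensorProduct.induction_on with
        | zero => simp
        | add s t hs ht => simp only [map_add, hs, ht, TensorProduct.add_tmul]
        | tmul a b => simp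
    have h2 : ∀ t : TensorAlgebra K V ⊗[K] TensorAlgebra K V,
        (deconcatenation K V).lTensor _
          ((LinearMap.mulLeft K (TensorAlgebra.ι K v)).rTensor _ t) =
        (LinearMap.mulLeft K (TensorAlgebra.ι K v)).rTensor _
          ((deconcatenation K V).lTensor _ t) := by
      intro t
      induction t using TensorProduct.induction_on with
      | zero => simp
      | add s t hs ht => simp only [map_add, hs, ht]
      | tmul a b => simp
    rw [deconcatenation_ι_mul, map_add, map_add, map_add, h1, h2, hx, LinearMap.rTensor_tmul,
      LinearMap.lTensor_tmul, deconcatenation_one, TensorProduct.assoc_tmul,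
      deconcatenation_ι_mul, TensorProduct.tmul_add, add_assoc]

noncomputable instance : Coalgebra K (TensorCoalgebra K V) where
  coassoc := LinearMap.ext (deconcatenation_coassoc K V)
  rTensor_counit_comp_comul := by
    ext1 x
    change (TensorAlgebra.algebraMapInv (R := K) (M := V)).toLinearMap.rTensor _
      (deconcatenation K V x) = 1 ⊗ₜ x
    induction x using induction_left with
    | h1 => simp [deconcatenation_one]
    | hsmul c x hx => rw [map_smul, map_smul, hx, TensorProduct.tmul_smul]
    | hadd x y hx hy => rw [map_add, map_add, hx, hy, TensorProduct.tmul_add]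
    | hmul v x hx =>
      rw [deconcatenation_ι_mul, map_add]
      have : ∀ t : TensorAlgebra K V ⊗[K] TensorAlgebra K V,
        (TensorAlgebra.algebraMapInv (R := K) (M := V)).toLinearMap.rTensor _
          ((LinearMap.mulLeft K (TensorAlgebra.ι K v)).rTensor _ t) = 0 := by
        intro t
        induction t using TensorProduct.induction_on with
        | zero => simp
        | add s t hs ht => simp only [map_add, hs, ht, add_zero]
        | tmul a b => simp [TensorAlgebra.algebraMapInv]
      rw [this]
      simp
  lTensor_counit_comp_comul := by
    ext1 x
    change (TensorAlgebra.algebraMapInv (R := K) (M := V)).toLinearMap.lTensor _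
      (deconcatenation K V x) = x ⊗ₜ 1
    induction x using induction_left with
    | h1 => simp [deconcatenation_one]
    | hsmul c x hx => rw [map_smul, map_smul, hx, TensorProduct.smul_tmul']
    | hadd x y hx hy => rw [map_add, map_add, hx, hy, TensorProduct.add_tmul]
    | hmul v x hx =>
      rw [deconcatenation_ι_mul, map_add]
      have : ∀ t : TensorAlgebra K V ⊗[K] TensorAlgebra K V,
        (TensorAlgebra.algebraMapInv (R := K) (M := V)).toLinearMap.lTensor _
          ((LinearMap.mulLeft K (TensorAlgebra.ι K v)).rTensor _ t) =
        (LinearMap.mulLeft K (TensorAlgebra.ι K v)).rTensor _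
          ((TensorAlgebra.algebraMapInv (R := K) (M := V)).toLinearMap.lTensor _ t) := by
        intro t
        induction t using TensorProduct.induction_on with
        | zero => simp
        | add s t hs ht => simp only [map_add, hs, ht]
        | tmul a b => simp
      rw [this, hx]
      simp [TensorAlgebra.algebraMapInv]

end TensorCoalgebra

end TensorCoalgebra

/-- A bialgebra is cofree (among connected coalgebras) if it is isomorphic, as a coalgebra, to the
tensor coalgebra over its space of primitive elements. -/
def IsCofree (K H : Type*) [CommRing K] [Ring H] [Bialgebra K H] : Prop :=
  Nonempty (H ≃ₗc[K] TensorCoalgebra K (Prim K H))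

/-- A (unital) 2-associative algebra: the associative product `*` is the ring multiplication, and
`dot` is a second associative product with the same unit. -/
class TwoAssociativeAlgebra (K A : Type*) [CommRing K] [Ring A] [Algebra K A] where
  dot : A →ₗ[K] A →ₗ[K] A
  dot_assoc : ∀ x y z : A, dot (dot x y) z = dot x (dot y z)
  one_dot : ∀ x : A, dot 1 x = x
  dot_one : ∀ x : A, dot x 1 = x

open TwoAssociativeAlgebra

section Blockings

/-- All ways of cutting the pair of words `(u, v)` into `k` consecutive pairs of blocks
`(u⁽¹⁾, v⁽¹⁾), …, (u⁽ᵏ⁾, v⁽ᵏ⁾)`, `u = u⁽¹⁾⋯u⁽ᵏ⁾`, `v = v⁽¹⁾⋯v⁽ᵏ⁾`, where either block of a pair may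
be empty but not both; they correspond to the indices `(i₁, …, i_k; j₁, …, j_k)` with
`i₁ + ⋯ + i_k = p`, `j₁ + ⋯ + j_k = q`. Pairs `(i_s, j_s) = (0, 0)` are left out: they contribute
nothing to the sums below since `M₀₀ = 0`. -/
def blockings {α : Type*} : ℕ → List α → List α → List (List (List α × List α))
  | 0, [], [] => [[]]
  | 0, _, _ => []
  | k + 1, u, v =>
      (((List.range (u.length + 1)) ×ˢ (List.range (v.length + 1))).filter (· ≠ (0, 0))).flatMap
        fun ij => (blockings k (u.drop ij.1) (v.drop ij.2)).map
          fun π => (u.take ij.1, v.take ij.2) :: π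

theorem mem_blockings {α : Type*} {k : ℕ} {u v : List α} {π : List (List α × List α)} :
    π ∈ blockings k u v ↔ π.length = k ∧ (π.map Prod.fst).flatten = u ∧
      (π.map Prod.snd).flatten = v ∧ ∀ b ∈ π, b ≠ ([], []) := by
  induction k generalizing u v π with
  | zero =>
    cases u <;> cases v <;> cases π <;> simp [blockings]
  | succ k ih =>
    simp only [blockings, List.mem_flatMap, List.mem_filter, List.mem_map, ih, Prod.exists,
      List.mem_product, List.mem_range, decide_eq_true_eq]
    constructor
    · rintro ⟨i, j, ⟨⟨hi, hj⟩, hij⟩, π', ⟨h1, h2, h3, h4⟩, rfl⟩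
      refine ⟨by simp [h1], by simp [h2], by simp [h3], ?_⟩
      intro b hb
      rcases List.mem_cons.1 hb with rfl | hb
      · intro h
        apply hij
        have h5 := congrArg (fun b => b.1.length) h
        have h6 := congrArg (fun b => b.2.length) h
        simp only [List.length_take, List.length_nil] at h5 h6
        ext <;> simp <;> omega
      · exact h4 b hb
    · rintro ⟨h1, h2, h3, h4⟩
      match π, h1, h2, h3, h4 with
      | (a, b) :: π, h1, h2, h3, h4 =>
        simp only [List.map_cons, List.flatten_cons] at h2 h3
        subst h2 h3
        refine ⟨a.length, b.length, ⟨⟨by simp, by simp⟩, ?_⟩, π, ⟨by simpa using h1,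
          by simp, by simp, fun c hc => h4 c (List.mem_cons_of_mem _ hc)⟩, by simp⟩
        intro h
        apply h4 (a, b) List.mem_cons_self
        simpa using h

theorem length_lt_of_mem_blockings {α : Type*} {k : ℕ} {u v : List α}
    {π : List (List α × List α)} (hk : 2 ≤ k) (hπ : π ∈ blockings k u v)
    {b : List α × List α} (hb : b ∈ π) :
    b.1.length + b.2.length < u.length + v.length := by
  obtain ⟨h1, rfl, rfl, h4⟩ := mem_blockings.1 hπ
  obtain ⟨s, t, rfl⟩ := List.append_of_mem hb
  have key : ∃ c ∈ s ++ t, c ≠ ([], []) := by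
    have hl : 0 < (s ++ t).length := by
      simp only [List.length_append, List.length_cons] at h1 ⊢; omega
    obtain ⟨c, hc⟩ := List.exists_mem_of_length_pos hl
    refine ⟨c, hc, h4 c ?_⟩
    simp only [List.mem_append, List.mem_cons] at hc ⊢
    tauto
  obtain ⟨c, hc, hne⟩ := key
  have hpos : 0 < c.1.length + c.2.length := by
    rcases c with ⟨_ | _, _ | _⟩ <;> simp at hne ⊢
  have hle : c.1.length + c.2.length ≤ ((s ++ t).map Prod.fst).flatten.length +
      ((s ++ t).map Prod.snd).flatten.length := by
    rw [List.length_flatten, List.length_flatten, List.map_map, List.map_map]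
    exact Nat.add_le_add
      (List.single_le_sum (by simp) _ (List.mem_map_of_mem (f := List.length ∘ Prod.fst) hc))
      (List.single_le_sum (by simp) _ (List.mem_map_of_mem (f := List.length ∘ Prod.snd) hc))
  simp only [List.map_append, List.flatten_append, List.length_append, List.map_cons,
    List.flatten_cons] at hle ⊢
  omega

/-- The sum of `f (u⁽¹⁾, v⁽¹⁾; …; u⁽ᵏ⁾, v⁽ᵏ⁾)` over all `k ≥ 1` and all cuttings of `(u, v)` into `k`
pairs of blocks. -/
def blockSum {α B : Type*} [AddCommMonoid B] (f : List (List α × List α) → B) (u v : List α) : B :=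
  ∑ k ∈ Finset.Icc 1 (u.length + v.length), ((blockings k u v).map f).sum

end Blockings

/-- A `B_∞`-algebra. The operation `M_{pq} : R^{⊗p} ⊗ R^{⊗q} → R` is given, as a multilinear map, by
the values `op u v` on words `u` of length `p` and `v` of length `q`. -/
class BInfinityAlgebra (K R : Type*) [CommRing K] [AddCommGroup R] [Module K R] where
  op : List R → List R → R
  op_add_left : ∀ (a b v : List R) (x y : R),
    op (a ++ (x + y) :: b) v = op (a ++ x :: b) v + op (a ++ y :: b) v
  op_smul_left : ∀ (a b v : List R) (c : K) (x : R),
    op (a ++ (c • x) :: b) v = c • op (a ++ x :: b) v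
  op_add_right : ∀ (u a b : List R) (x y : R),
    op u (a ++ (x + y) :: b) = op u (a ++ x :: b) + op u (a ++ y :: b)
  op_smul_right : ∀ (u a b : List R) (c : K) (x : R),
    op u (a ++ (c • x) :: b) = c • op u (a ++ x :: b)
  op_nil_nil : op [] [] = 0
  op_singleton_nil : ∀ x, op [x] [] = x
  op_nil_singleton : ∀ x, op [] [x] = x
  op_left_nil : ∀ u : List R, 2 ≤ u.length → op u [] = 0
  op_nil_right : ∀ v : List R, 2 ≤ v.length → op [] v = 0
  /-- The associativity relations, one for each triple of positive lengths. -/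
  op_rel : ∀ u v w : List R, u ≠ [] → v ≠ [] → w ≠ [] →
    blockSum (fun π => op (π.map fun b => op b.1 b.2) w) u v =
      blockSum (fun π => op u (π.map fun b => op b.1 b.2)) v w

section TwoAssociative

variable (K : Type*) {A : Type*} [CommRing K] [Ring A] [Algebra K A] [TwoAssociativeAlgebra K A]

/-- The iterated product `u₁ · u₂ · ⋯ · uₙ` for the second product. -/
def dotProd (l : List A) : A := l.foldr (fun x y => dot (K := K) x y) 1

/-- The operations `M_{pq}` on a 2-associative algebra, defined by induction on `p + q`. -/
def opM : List A → List A → A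
  | [], [] => 0
  | [x], [] => x
  | [], [y] => y
  | _ :: _ :: _, [] => 0
  | [], _ :: _ :: _ => 0
  | x :: u, y :: v =>
      dotProd K (x :: u) * dotProd K (y :: v) -
        ∑ k ∈ (Finset.Icc 2 ((x :: u).length + (y :: v).length)).attach,
          ((blockings k (x :: u) (y :: v)).attach.map fun π =>
            dotProd K (π.1.attach.map fun b => opM b.1.1 b.1.2)).sum
  termination_by u v => u.length + v.length
  decreasing_by exact length_lt_of_mem_blockings (Finset.mem_Icc.1 k.2).1 π.2 b.2

theorem opM_of_ne_nil {u v : List A} (hu : u ≠ []) (hv : v ≠ []) :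
    opM K u v = dotProd K u * dotProd K v - ∑ k ∈ Finset.Icc 2 (u.length + v.length),
      ((blockings k u v).map fun π => dotProd K (π.map fun b => opM K b.1 b.2)).sum := by
  match u, v, hu, hv with
  | x :: u, y :: v, _, _ =>
    rw [opM, ← Finset.sum_attach (Finset.Icc 2 _)]
    congr 1
    refine Finset.sum_congr rfl fun k _ => ?_
    have h : ∀ π : List (List A × List A),
        (π.attach.map fun b => opM K b.1.1 b.1.2) = π.map fun b => opM K b.1 b.2 := fun π =>
      List.attach_map_val (l := π) (f := fun b => opM K b.1 b.2)
    simp [h]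

/-- The 2-sided ideal, in the sense of 2-associative algebras, generated by `s`. -/
def twoIdealSpan (s : Set A) : TwoSidedIdeal A :=
  sInf {I | s ⊆ I ∧ ∀ a x, x ∈ I → dot (K := K) a x ∈ I ∧ dot (K := K) x a ∈ I}

end TwoAssociative

/-- A 2-associative bialgebra: `(A, *, Δ)` is a bialgebra and `(A, ·, Δ)` is a unital infinitesimal
bialgebra. -/
structure IsTwoAssociativeBialgebra (K A : Type*) [CommRing K] [Ring A] [Algebra K A]
    [Coalgebra K A] [TwoAssociativeAlgebra K A] : Prop where
  counit_one : Coalgebra.counit (R := K) (1 : A) = 1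
  counit_mul : ∀ x y : A, Coalgebra.counit (R := K) (x * y) =
    Coalgebra.counit (R := K) x * Coalgebra.counit (R := K) y
  comul_one : Coalgebra.comul (R := K) (1 : A) = 1 ⊗ₜ 1
  comul_mul : ∀ x y : A, Coalgebra.comul (R := K) (x * y) =
    Coalgebra.comul (R := K) x * Coalgebra.comul (R := K) y
  /-- The unital infinitesimal relation `Δ(x·y) = (x ⊗ 1)·Δ(y) + Δ(x)·(1 ⊗ y) - x ⊗ y`. -/
  comul_dot : ∀ x y : A, Coalgebra.comul (R := K) (dot (K := K) x y) =
    TensorProduct.map₂ (dot (K := K)) (dot (K := K)) (x ⊗ₜ[K] (1 : A)) (Coalgebra.comul y) +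
    TensorProduct.map₂ (dot (K := K)) (dot (K := K)) (Coalgebra.comul x) ((1 : A) ⊗ₜ[K] y) -
    x ⊗ₜ[K] y

/-- Isomorphisms of 2-associative bialgebras. -/
structure TwoAssociativeBialgebraIso (K A B : Type*) [CommRing K] [Ring A] [Algebra K A]
    [Coalgebra K A] [TwoAssociativeAlgebra K A] [Ring B] [Algebra K B] [Coalgebra K B]
    [TwoAssociativeAlgebra K B] extends A ≃ₗc[K] B where
  map_one' : toFun 1 = 1
  map_mul' : ∀ x y, toFun (x * y) = toFun x * toFun y
  map_dot' : ∀ x y, toFun (dot (K := K) x y) = dot (K := K) (toFun x) (toFun y)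

section Free

variable (K V : Type*) [CommRing K] [AddCommGroup V] [Module K V]

namespace FreeTwoAssociative

/-- Terms in the operations of 2-associative `K`-algebras with constants from `K` and `V`. -/
inductive Pre
  | of : V → Pre
  | scalar : K → Pre
  | add : Pre → Pre → Pre
  | mul : Pre → Pre → Pre
  | dot : Pre → Pre → Pre

/-- The axioms of 2-associative `K`-algebras, and linearity of `V → Pre`. -/
inductive Rel : Pre K V → Pre K V → Prop
  | of_add (v w : V) : Rel (.of (v + w)) (.add (.of v) (.of w))
  | of_smul (c : K) (v : V) : Rel (.of (c • v)) (.mul (.scalar c) (.of v))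
  | scalar_add (c d : K) : Rel (.scalar (c + d)) (.add (.scalar c) (.scalar d))
  | scalar_mul (c d : K) : Rel (.scalar (c * d)) (.mul (.scalar c) (.scalar d))
  | scalar_central (c : K) (a : Pre K V) : Rel (.mul (.scalar c) a) (.mul a (.scalar c))
  | add_assoc (a b c : Pre K V) : Rel (.add (.add a b) c) (.add a (.add b c))
  | add_comm (a b : Pre K V) : Rel (.add a b) (.add b a)
  | zero_add (a : Pre K V) : Rel (.add (.scalar 0) a) a
  | zero_mul (a : Pre K V) : Rel (.mul (.scalar 0) a) (.scalar 0)
  | mul_zero (a : Pre K V) : Rel (.mul a (.scalar 0)) (.scalar 0)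
  | mul_assoc (a b c : Pre K V) : Rel (.mul (.mul a b) c) (.mul a (.mul b c))
  | one_mul (a : Pre K V) : Rel (.mul (.scalar 1) a) a
  | mul_one (a : Pre K V) : Rel (.mul a (.scalar 1)) a
  | mul_add (a b c : Pre K V) : Rel (.mul a (.add b c)) (.add (.mul a b) (.mul a c))
  | add_mul (a b c : Pre K V) : Rel (.mul (.add a b) c) (.add (.mul a c) (.mul b c))
  | dot_assoc (a b c : Pre K V) : Rel (.dot (.dot a b) c) (.dot a (.dot b c))
  | one_dot (a : Pre K V) : Rel (.dot (.scalar 1) a) a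
  | dot_one (a : Pre K V) : Rel (.dot a (.scalar 1)) a
  | dot_add (a b c : Pre K V) : Rel (.dot a (.add b c)) (.add (.dot a b) (.dot a c))
  | add_dot (a b c : Pre K V) : Rel (.dot (.add a b) c) (.add (.dot a c) (.dot b c))
  | smul_dot (c : K) (a b : Pre K V) :
      Rel (.dot (.mul (.scalar c) a) b) (.mul (.scalar c) (.dot a b))
  | dot_smul (c : K) (a b : Pre K V) :
      Rel (.dot a (.mul (.scalar c) b)) (.mul (.scalar c) (.dot a b))
  | add_congr_left (a b c : Pre K V) : Rel a b → Rel (.add a c) (.add b c)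
  | add_congr_right (a b c : Pre K V) : Rel a b → Rel (.add c a) (.add c b)
  | mul_congr_left (a b c : Pre K V) : Rel a b → Rel (.mul a c) (.mul b c)
  | mul_congr_right (a b c : Pre K V) : Rel a b → Rel (.mul c a) (.mul c b)
  | dot_congr_left (a b c : Pre K V) : Rel a b → Rel (.dot a c) (.dot b c)
  | dot_congr_right (a b c : Pre K V) : Rel a b → Rel (.dot c a) (.dot c b)

end FreeTwoAssociative

open FreeTwoAssociative in
/-- The free 2-associative algebra over the vector space `V`. -/
def FreeTwoAssociative : Type _ := Quot (Rel K V)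

namespace FreeTwoAssociative

instance : Add (FreeTwoAssociative K V) :=
  ⟨Quot.map₂ .add (fun _ _ _ => .add_congr_right _ _ _) (fun _ _ _ => .add_congr_left _ _ _)⟩

instance : Mul (FreeTwoAssociative K V) :=
  ⟨Quot.map₂ .mul (fun _ _ _ => .mul_congr_right _ _ _) (fun _ _ _ => .mul_congr_left _ _ _)⟩

instance : Zero (FreeTwoAssociative K V) := ⟨Quot.mk _ (.scalar 0)⟩

instance : One (FreeTwoAssociative K V) := ⟨Quot.mk _ (.scalar 1)⟩

instance : Semiring (FreeTwoAssociative K V) where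
  nsmul := nsmulRec
  add_assoc := by rintro ⟨a⟩ ⟨b⟩ ⟨c⟩; exact Quot.sound (.add_assoc a b c)
  zero_add := by rintro ⟨a⟩; exact Quot.sound (.zero_add a)
  add_zero := by
    rintro ⟨a⟩; exact (Quot.sound (.add_comm _ _)).trans (Quot.sound (.zero_add a))
  add_comm := by rintro ⟨a⟩ ⟨b⟩; exact Quot.sound (.add_comm a b)
  mul_assoc := by rintro ⟨a⟩ ⟨b⟩ ⟨c⟩; exact Quot.sound (.mul_assoc a b c)
  one_mul := by rintro ⟨a⟩; exact Quot.sound (.one_mul a)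
  mul_one := by rintro ⟨a⟩; exact Quot.sound (.mul_one a)
  zero_mul := by rintro ⟨a⟩; exact Quot.sound (.zero_mul a)
  mul_zero := by rintro ⟨a⟩; exact Quot.sound (.mul_zero a)
  left_distrib := by rintro ⟨a⟩ ⟨b⟩ ⟨c⟩; exact Quot.sound (.mul_add a b c)
  right_distrib := by rintro ⟨a⟩ ⟨b⟩ ⟨c⟩; exact Quot.sound (.add_mul a b c)

instance : Algebra K (FreeTwoAssociative K V) where
  smul c := Quot.map (.mul (.scalar c)) (fun _ _ => .mul_congr_right _ _ _)
  algebraMap :=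
    { toFun := fun c => Quot.mk _ (.scalar c)
      map_one' := rfl
      map_zero' := rfl
      map_add' := fun c d => Quot.sound (.scalar_add c d)
      map_mul' := fun c d => Quot.sound (.scalar_mul c d) }
  commutes' := by rintro c ⟨a⟩; exact Quot.sound (.scalar_central c a)
  smul_def' := by rintro c ⟨a⟩; rfl

instance : Ring (FreeTwoAssociative K V) := Algebra.semiringToRing K

instance : TwoAssociativeAlgebra K (FreeTwoAssociative K V) where
  dot := LinearMap.mk₂ K
    (Quot.map₂ .dot (fun _ _ _ => .dot_congr_right _ _ _) (fun _ _ _ => .dot_congr_left _ _ _))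
    (by rintro ⟨a⟩ ⟨b⟩ ⟨c⟩; exact Quot.sound (.add_dot a b c))
    (by rintro c ⟨a⟩ ⟨b⟩; exact Quot.sound (.smul_dot c a b))
    (by rintro ⟨a⟩ ⟨b⟩ ⟨c⟩; exact Quot.sound (.dot_add a b c))
    (by rintro c ⟨a⟩ ⟨b⟩; exact Quot.sound (.dot_smul c a b))
  dot_assoc := by rintro ⟨a⟩ ⟨b⟩ ⟨c⟩; exact Quot.sound (.dot_assoc a b c)
  one_dot := by rintro ⟨a⟩; exact Quot.sound (.one_dot a)
  dot_one := by rintro ⟨a⟩; exact Quot.sound (.dot_one a)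

/-- The canonical inclusion `V → 2as(V)`. -/
def ι : V →ₗ[K] FreeTwoAssociative K V where
  toFun v := Quot.mk _ (.of v)
  map_add' v w := Quot.sound (.of_add v w)
  map_smul' c v := Quot.sound (.of_smul c v)

end FreeTwoAssociative

end Free

section U2

variable (K R : Type*) [CommRing K] [AddCommGroup R] [Module K R] [BInfinityAlgebra K R]

namespace U2

/-- The ideal of `2as(R)` generated by the elements `M_{pq}(r, s) - M̃_{pq}(r, s)`, where `M` is the
operation of `R` and `M̃` that of `2as(R)`. -/
def relIdeal : TwoSidedIdeal (FreeTwoAssociative K R) :=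
  twoIdealSpan K {x | ∃ r s : List R,
    x = FreeTwoAssociative.ι K R (BInfinityAlgebra.op K r s) -
      opM K (r.map (FreeTwoAssociative.ι K R)) (s.map (FreeTwoAssociative.ι K R))}

end U2

/-- The universal enveloping 2-associative algebra of a `B_∞`-algebra. -/
def U2 : Type _ := (U2.relIdeal K R).ringCon.Quotient

namespace U2

instance : Ring (U2 K R) := inferInstanceAs (Ring (relIdeal K R).ringCon.Quotient)

instance : Algebra K (U2 K R) := inferInstanceAs (Algebra K (relIdeal K R).ringCon.Quotient)

/-- The projection `2as(R) → U2(R)`. -/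
def mk : FreeTwoAssociative K R →ₐ[K] U2 K R := (relIdeal K R).ringCon.mkₐ K

theorem mk_surjective : Function.Surjective (mk K R) := Quotient.mk_surjective

theorem mk_eq_mk (x y : FreeTwoAssociative K R) : mk K R x = mk K R y ↔ x - y ∈ relIdeal K R := by
  rw [← TwoSidedIdeal.rel_iff]
  exact (relIdeal K R).ringCon.eq

theorem dot_mem_relIdeal (a x : FreeTwoAssociative K R) (hx : x ∈ relIdeal K R) :
    dot (K := K) a x ∈ relIdeal K R ∧ dot (K := K) x a ∈ relIdeal K R := by
  unfold relIdeal twoIdealSpan at *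
  rw [TwoSidedIdeal.mem_sInf] at *
  rw [TwoSidedIdeal.mem_sInf]
  exact ⟨fun I hI => (hI.2 a x (hx I hI)).1, fun I hI => (hI.2 a x (hx I hI)).2⟩

theorem mk_dot_congr (x x' y y' : FreeTwoAssociative K R) (hx : mk K R x = mk K R x')
    (hy : mk K R y = mk K R y') : mk K R (dot (K := K) x y) = mk K R (dot (K := K) x' y') := by
  rw [mk_eq_mk] at *
  have h : dot (K := K) x y - dot (K := K) x' y' =
      dot (K := K) (x - x') y + dot (K := K) x' (y - y') := by
    simp only [map_sub, LinearMap.sub_apply]; abel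
  rw [h]
  exact add_mem (dot_mem_relIdeal K R y _ hx).2 (dot_mem_relIdeal K R x' _ hy).1

/-- The second product on `U2(R)`, as a map; it satisfies `mk x · mk y = mk (x · y)`. -/
def dotFun : U2 K R → U2 K R → U2 K R :=
  Quotient.map₂ (fun x y => dot (K := K) x y) fun x x' hx y y' hy =>
    Quotient.exact (mk_dot_congr K R x x' y y' (Quotient.sound hx) (Quotient.sound hy))

theorem dotFun_mk (x y : FreeTwoAssociative K R) :
    dotFun K R (mk K R x) (mk K R y) = mk K R (dot (K := K) x y) := rfl

instance : TwoAssociativeAlgebra K (U2 K R) where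
  dot := LinearMap.mk₂ K (dotFun K R)
    (by
      intro a b c
      obtain ⟨a, rfl⟩ := mk_surjective K R a
      obtain ⟨b, rfl⟩ := mk_surjective K R b
      obtain ⟨c, rfl⟩ := mk_surjective K R c
      rw [← map_add, dotFun_mk, map_add (dot (K := K)), LinearMap.add_apply, map_add]; rfl)
    (by
      intro t a b
      obtain ⟨a, rfl⟩ := mk_surjective K R a
      obtain ⟨b, rfl⟩ := mk_surjective K R b
      rw [← map_smul, dotFun_mk, map_smul (dot (K := K)), LinearMap.smul_apply, map_smul]; rfl)
    (by
      intro a b c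
      obtain ⟨a, rfl⟩ := mk_surjective K R a
      obtain ⟨b, rfl⟩ := mk_surjective K R b
      obtain ⟨c, rfl⟩ := mk_surjective K R c
      simp only [← map_add, dotFun_mk])
    (by
      intro t a b
      obtain ⟨a, rfl⟩ := mk_surjective K R a
      obtain ⟨b, rfl⟩ := mk_surjective K R b
      simp only [← map_smul, dotFun_mk])
  dot_assoc a b c := by
    obtain ⟨a, rfl⟩ := mk_surjective K R a
    obtain ⟨b, rfl⟩ := mk_surjective K R b
    obtain ⟨c, rfl⟩ := mk_surjective K R c
    simp only [LinearMap.mk₂_apply, dotFun_mk, dot_assoc]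
  one_dot a := by
    obtain ⟨a, rfl⟩ := mk_surjective K R a
    rw [← map_one (mk K R), LinearMap.mk₂_apply, dotFun_mk, one_dot]
  dot_one a := by
    obtain ⟨a, rfl⟩ := mk_surjective K R a
    rw [← map_one (mk K R), LinearMap.mk₂_apply, dotFun_mk, dot_one]

/-- The canonical map `R → U2(R)`. -/
def ι : R →ₗ[K] U2 K R := (mk K R).toLinearMap ∘ₗ FreeTwoAssociative.ι K R

variable {K R} in
/-- `U2(R)` is generated by `R` as a 2-associative algebra. -/
theorem induction {C : U2 K R → Prop} (hι : ∀ r, C (ι K R r)) (hscalar : ∀ c : K, C (algebraMap K _ c))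
    (hadd : ∀ x y, C x → C y → C (x + y)) (hmul : ∀ x y, C x → C y → C (x * y))
    (hdot : ∀ x y, C x → C y → C (dot (K := K) x y)) (x : U2 K R) : C x := by
  obtain ⟨⟨t⟩, rfl⟩ := mk_surjective K R x
  induction t with
  | of v => exact hι v
  | scalar c => exact hscalar c
  | add a b ha hb => exact hadd _ _ ha hb
  | mul a b ha hb => exact hmul _ _ ha hb
  | dot a b ha hb => exact hdot _ _ ha hb

theorem counit_unique {A : Type*} [AddCommGroup A] [Module K A] (c c' : Coalgebra K A)
    (h : c.comul = c'.comul) : c.counit = c'.counit := by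
  ext x
  have h1 := LinearMap.congr_fun c.rTensor_counit_comp_comul x
  have h2 := LinearMap.congr_fun c'.lTensor_counit_comp_comul x
  rw [← h] at h2
  have h3 := LinearMap.congr_fun
    ((LinearMap.lTensor_comp_rTensor A c.counit c'.counit).trans
      (LinearMap.rTensor_comp_lTensor A c.counit c'.counit).symm) (c.comul x)
  simp only [LinearMap.comp_apply] at h1 h2 h3
  rw [h1, h2] at h3
  simpa using (congrArg (TensorProduct.lid K K) h3).symm

/-- There is at most one coproduct (and counit) that makes `U2(R)` a 2-associative bialgebra in which
the elements of `R` are primitive. -/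
theorem coalgebra_unique (c c' : Coalgebra K (U2 K R))
    (h : @IsTwoAssociativeBialgebra K (U2 K R) _ _ _ c _)
    (h' : @IsTwoAssociativeBialgebra K (U2 K R) _ _ _ c' _)
    (hp : ∀ r, ι K R r ∈ @Prim K (U2 K R) _ _ _ c)
    (hp' : ∀ r, ι K R r ∈ @Prim K (U2 K R) _ _ _ c') :
    c.comul = c'.comul ∧ c.counit = c'.counit := by
  have hc : ∀ x, c.comul x = c'.comul x := by
    intro x
    induction x using induction with
    | hι r => exact (hp r).trans (hp' r).symm
    | hscalar t =>
      rw [Algebra.algebraMap_eq_smul_one, map_smul, map_smul]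
      exact congrArg _ ((@IsTwoAssociativeBialgebra.comul_one _ _ _ _ _ c _ h).trans
        (@IsTwoAssociativeBialgebra.comul_one _ _ _ _ _ c' _ h').symm)
    | hadd x y hx hy => rw [map_add, map_add, hx, hy]
    | hmul x y hx hy =>
      refine (@IsTwoAssociativeBialgebra.comul_mul _ _ _ _ _ c _ h x y).trans
        (Eq.trans ?_ (@IsTwoAssociativeBialgebra.comul_mul _ _ _ _ _ c' _ h' x y).symm)
      rw [hx, hy]
    | hdot x y hx hy =>
      refine (@IsTwoAssociativeBialgebra.comul_dot _ _ _ _ _ c _ h x y).trans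
        (Eq.trans ?_ (@IsTwoAssociativeBialgebra.comul_dot _ _ _ _ _ c' _ h' x y).symm)
      rw [hx, hy]
  have hc' : c.comul = c'.comul := LinearMap.ext hc
  exact ⟨hc', counit_unique K c c' hc'⟩

end U2

end U2

section Main

variable (K H : Type*) [CommRing K] [Ring H] [Bialgebra K H]

/-- `B_∞`-structures on `Prim H` for which `Prim H` is a sub-`B_∞`-algebra of the 2-associative
algebra `H`. Since the operations are determined by those of `H`, there is at most one. -/
def IsSubBInfinity [TwoAssociativeAlgebra K H] [BInfinityAlgebra K (Prim K H)] : Prop :=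
  ∀ u v : List (Prim K H),
    ((BInfinityAlgebra.op K u v : Prim K H) : H) = opM K (u.map Subtype.val) (v.map Subtype.val)

/-- `H` is isomorphic to `U2(Prim H)` as a 2-associative bialgebra. Here `Prim H` is a
sub-`B_∞`-algebra of `H`, and the coproduct of `U2(Prim H)` is the one that makes it a 2-associative
bialgebra in which the elements of `Prim H` are primitive (see `U2.coalgebra_unique`). -/
def IsIsoU2Prim [TwoAssociativeAlgebra K H] : Prop :=
  ∃ _ : BInfinityAlgebra K (Prim K H), IsSubBInfinity K H ∧
    ∃ _ : Coalgebra K (U2 K (Prim K H)),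
      IsTwoAssociativeBialgebra K (U2 K (Prim K H)) ∧
      (∀ r, U2.ι K (Prim K H) r ∈ Prim K (U2 K (Prim K H))) ∧
      Nonempty (TwoAssociativeBialgebraIso K H (U2 K (Prim K H)))

end Main

end LodayRonco

/-!
Write `P` for the space of primitive elements and `T(P)` for the tensor coalgebra. Given a second
product `·`, the linear map `θ = dotLift : T(P) → H` that sends a word `p₁ ⋯ pₙ` to `p₁ · … · pₙ` is
a coalgebra map: for primitive `p` the unital infinitesimal relation reads
`Δ(p · x) = 1 ⊗ p · x + (p · ⊗ id) Δ x`, which is the recursion that defines deconcatenation. It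
carries the equivalences.

* `θ` is injective, because it is so on letters, `T(P)` is connected, and elements of `T(P)` with zero
  reduced coproduct lie in `K ⊕ P` (`TensorCoalgebra.injective_of_injective_ι`).
* If `H` is connected, `θ` is surjective (`dotLift_subtype_surjective`). Choose a linear `e : H → P`
  for which `e ∘ θ` is the projection of words onto letters. The convolution `D x = e(x₍₁₎) · x₍₂₎`
  satisfies `D x = x - ε(x) 1` on the image of `θ`, since it removes a first letter and puts it back.
  By coassociativity, `x - D x - ε(x) 1` is primitive as soon as the reduced coproduct of `x` lies in
  the tensor square of the image. Hence `H` is cofree.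
* A cofree bialgebra is connected, and concatenation, transported to `H`, is a second product; its
  unit is the unit of `H` because `1` is the only group-like element of a tensor coalgebra
  (`TensorCoalgebra.eq_one_of_comul_eq`).
* If `θ` is bijective, iterating `x = D x + ε(x) 1` on `x = θ(u) * θ(v)` expands the product `*` of two
  words as the sum over all cuttings of `(u, v)` into pairs of blocks, with the value
  `e(θ(u⁽ⁱ⁾) * θ(v⁽ⁱ⁾))` on each pair (`dotProd_mul_dotProd_eq_totalBlockSum`). This is the recursion
  that defines the operations `M`, so `M` takes primitive elements to primitive elements, and
  the relations of a `B_∞`-algebra are the image under `e` of the associativity of `*`.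
* In `U2(R)` the products `r₁ · … · rₙ` span, because the defining relations expand the product `*`
  of two of them in such products (`U2.dotLift_ι_surjective`). So when `θ` is bijective,
  `T(P) → U2(P) → H` has a surjective first factor and a bijective composite, and `U2(P) → H` is an
  isomorphism, along which the coproduct is transported. Conversely, if `U2(P)` carries the coproduct,
  `T(P) → U2(P)` is a surjective coalgebra map, and connectedness passes from `T(P)` to `U2(P) ≅ H`.
-/

namespace LodayRonco

open TwoAssociativeAlgebra TensorProduct

/-! ### The coradical filtration and coalgebra maps -/

section Filtration

section CommRing

variable {K A : Type*} [CommRing K] [Ring A] [Algebra K A] [Coalgebra K A]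

theorem reducedComul_apply (x : A) : reducedComul K A x =
      Coalgebra.comul (R := K) x - x ⊗ₜ[K] (1 : A) - (1 : A) ⊗ₜ[K] x := rfl

theorem mem_coradicalFiltration_succ {n : ℕ} {x : A} : x ∈ coradicalFiltration K A (n + 1) ↔
      reducedComul K A x ∈ LinearMap.range (TensorProduct.mapIncl
        (coradicalFiltration K A n) (coradicalFiltration K A n)) := Iff.rfl

theorem mem_Prim {x : A} : x ∈ Prim K A ↔
    Coalgebra.comul (R := K) x = x ⊗ₜ[K] (1 : A) + (1 : A) ⊗ₜ[K] x := Iff.rfl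

theorem mem_Prim_iff_reducedComul {x : A} :
    x ∈ Prim K A ↔ reducedComul K A x = 0 := by
  rw [mem_Prim, reducedComul_apply, sub_sub, sub_eq_zero]

theorem subtype_mem_Prim (v : Prim K A) : (Prim K A).subtype v ∈ Prim K A := v.2

end CommRing

variable {K C D : Type*} [Field K] [Ring C] [Algebra K C] [Coalgebra K C]
  [Ring D] [Algebra K D] [Coalgebra K D]

theorem reducedComul_map (f : C →ₗc[K] D) (hf : f 1 = 1) (x : C) :
    reducedComul K D (f x) =
      TensorProduct.map (f : C →ₗ[K] D) (f : C →ₗ[K] D) (reducedComul K C x) := by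
  have h := CoalgHomClass.map_comp_comul_apply f x
  simp only [reducedComul_apply, map_sub, TensorProduct.map_tmul]
  rw [← h]
  simp [hf]

theorem map_mem_coradicalFiltration (f : C →ₗc[K] D) (hf : f 1 = 1) (n : ℕ) {x : C}
    (hx : x ∈ coradicalFiltration K C n) : f x ∈ coradicalFiltration K D n := by
  induction n generalizing x with
  | zero =>
    obtain ⟨c, rfl⟩ := Submodule.mem_span_singleton.1 hx
    exact Submodule.mem_span_singleton.2 ⟨c, by simp [hf]⟩
  | succ n ih =>
    obtain ⟨t, ht⟩ := mem_coradicalFiltration_succ.1 hx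
    rw [mem_coradicalFiltration_succ, reducedComul_map f hf, ← ht]
    clear ht
    induction t using TensorProduct.induction_on with
    | zero => simp
    | add s t hs ht => simpa only [map_add] using add_mem hs ht
    | tmul a b => exact ⟨⟨f a, ih a.2⟩ ⊗ₜ ⟨f b, ih b.2⟩, by simp [TensorProduct.mapIncl]⟩

theorem IsConnected.of_surjective (f : C →ₗc[K] D) (hf : f 1 = 1) (hs : Function.Surjective f)
    (h : IsConnected K C) : IsConnected K D := by
  intro y
  obtain ⟨x, rfl⟩ := hs y
  obtain ⟨n, hn⟩ := h x
  exact ⟨n, map_mem_coradicalFiltration f hf n hn⟩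

end Filtration

/-! ### The tensor coalgebra -/

namespace TensorCoalgebra

variable {K V : Type*} [Field K] [AddCommGroup V] [Module K V]

@[simp]
theorem word_nil : word K V [] = 1 := rfl

@[simp]
theorem word_cons (v : V) (l : List V) :
    word K V (v :: l) = TensorAlgebra.ι K v * word K V l := by
  simp [word]

theorem span_range_word : Submodule.span K (Set.range (word K V)) = ⊤ := by
  rw [eq_top_iff]
  rintro x -
  induction x using induction_left with
  | h1 => exact Submodule.subset_span ⟨[], rfl⟩
  | hsmul c x hx => exact Submodule.smul_mem _ c hx
  | hadd x y hx hy => exact add_mem hx hy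
  | hmul v x hx =>
    induction hx using Submodule.span_induction with
    | mem x hx =>
      obtain ⟨l, rfl⟩ := hx
      exact Submodule.subset_span ⟨v :: l, word_cons v l⟩
    | zero => simp
    | add x y _ _ hx hy => simpa only [mul_add] using add_mem hx hy
    | smul c x _ hx => simpa only [mul_smul_comm] using Submodule.smul_mem _ c hx

theorem comul_one : Coalgebra.comul (R := K) (1 : TensorCoalgebra K V) = 1 ⊗ₜ 1 :=
  deconcatenation_one K V

theorem comul_ι_mul (v : V) (x : TensorCoalgebra K V) :
    Coalgebra.comul (R := K) (TensorAlgebra.ι K v * x : TensorCoalgebra K V) =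
      1 ⊗ₜ (TensorAlgebra.ι K v * x) +
      (LinearMap.mulLeft K (TensorAlgebra.ι K v)).rTensor _ (Coalgebra.comul (R := K) x) :=
  deconcatenation_ι_mul K V v x

theorem counit_one : Coalgebra.counit (R := K) (1 : TensorCoalgebra K V) = 1 := by
  simpa using counit_word K V []

theorem counit_mul (x y : TensorCoalgebra K V) : Coalgebra.counit (R := K) (x * y) =
    Coalgebra.counit (R := K) x * Coalgebra.counit (R := K) y :=
  map_mul (TensorAlgebra.algebraMapInv (R := K) (M := V)) x y

theorem counit_ι (v : V) :
    Coalgebra.counit (R := K) (TensorAlgebra.ι K v : TensorCoalgebra K V) = 0 := by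
  simpa using counit_word K V [v]

theorem reducedComul_word_cons (v : V) (l : List V) :
    reducedComul K (TensorCoalgebra K V) (word K V (v :: l)) =
      ∑ i ∈ Finset.range l.length,
        word K V ((v :: l).take (i + 1)) ⊗ₜ[K] word K V ((v :: l).drop (i + 1)) := by
  rw [reducedComul_apply]
  have h := comul_word K V (v :: l)
  rw [List.length_cons, Finset.sum_range_succ', Finset.sum_range_succ] at h
  rw [h]
  simp
  abel

theorem word_mem_coradicalFiltration (n : ℕ) (l : List V) (hl : l.length ≤ n) :
    word K V l ∈ coradicalFiltration K (TensorCoalgebra K V) n := by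
  induction n generalizing l with
  | zero =>
    obtain rfl : l = [] := List.eq_nil_of_length_eq_zero (by omega)
    exact Submodule.subset_span rfl
  | succ n ih =>
    cases l with
    | nil =>
      have h1 : (1 : TensorCoalgebra K V) ∈ coradicalFiltration K (TensorCoalgebra K V) n :=
        ih [] (by simp)
      refine ⟨⟨_, neg_mem h1⟩ ⊗ₜ ⟨_, h1⟩, ?_⟩
      rw [reducedComul_apply, word_nil, comul_one, TensorProduct.mapIncl, TensorProduct.map_tmul]
      simp [TensorProduct.neg_tmul]
    | cons v l =>
      rw [mem_coradicalFiltration_succ, reducedComul_word_cons]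
      refine sum_mem fun i hi => ?_
      rw [Finset.mem_range] at hi
      simp only [List.length_cons] at hl
      refine ⟨⟨_, ih ((v :: l).take (i + 1)) ?_⟩ ⊗ₜ ⟨_, ih ((v :: l).drop (i + 1)) ?_⟩, ?_⟩
      · simp; omega
      · simp; omega
      · simp [TensorProduct.mapIncl]

/-- The tensor coalgebra is connected: a combination of words of length at most `r` lies in `F n` for
every `n ≥ r`. -/
theorem isConnected : IsConnected K (TensorCoalgebra K V) := by
  intro x
  have hx : x ∈ Submodule.span K (Set.range (word K V)) := by
    rw [span_range_word]; trivial
  suffices h : ∃ r, ∀ n, r ≤ n → x ∈ coradicalFiltration K (TensorCoalgebra K V) n from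
    h.imp fun r hr => hr r le_rfl
  induction hx using Submodule.span_induction with
  | mem x hx =>
    obtain ⟨l, rfl⟩ := hx
    exact ⟨l.length, fun n hn => word_mem_coradicalFiltration n l hn⟩
  | zero => exact ⟨0, fun n _ => zero_mem _⟩
  | add x y _ _ hx hy =>
    obtain ⟨r, hr⟩ := hx
    obtain ⟨s, hs⟩ := hy
    exact ⟨max r s, fun n hn => add_mem (hr n (by omega)) (hs n (by omega))⟩
  | smul c x _ hx =>
    obtain ⟨r, hr⟩ := hx
    exact ⟨r, fun n hn => Submodule.smul_mem _ c (hr n hn)⟩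

/-- The contraction `x ↦ f(x₍₁₎) x₍₂₎` with a linear form `f`. -/
noncomputable def contract (f : TensorCoalgebra K V →ₗ[K] K) :
    TensorCoalgebra K V →ₗ[K] TensorCoalgebra K V :=
  (TensorProduct.lid K _).toLinearMap ∘ₗ f.rTensor _ ∘ₗ Coalgebra.comul

theorem contract_word (f : TensorCoalgebra K V →ₗ[K] K) (l : List V) :
    contract f (word K V l) =
      ∑ i ∈ Finset.range (l.length + 1), f (word K V (l.take i)) • word K V (l.drop i) := by
  have h : Coalgebra.comul (R := K) (word K V l) = _ := comul_word K V l
  simp [contract, h, map_sum]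

theorem contract_pow_word (f : TensorCoalgebra K V →ₗ[K] K) (hf : f 1 = 0) (n : ℕ) (l : List V)
    (hl : l.length < n) : ((contract f) ^ n) (word K V l) = 0 := by
  induction n generalizing l with
  | zero => omega
  | succ n ih =>
    rw [pow_succ, Module.End.mul_apply, contract_word, map_sum]
    refine Finset.sum_eq_zero fun i hi => ?_
    rw [map_smul]
    rcases i with _ | i
    · simp [hf]
    · rcases l with _ | ⟨v, l⟩
      · simp at hi
      · rw [ih _ (by simp at hl ⊢; omega), smul_zero]

theorem exists_contract_pow_eq_zero (f : TensorCoalgebra K V →ₗ[K] K) (hf : f 1 = 0)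
    (x : TensorCoalgebra K V) : ∃ r, ∀ n, r ≤ n → ((contract f) ^ n) x = 0 := by
  have hx : x ∈ Submodule.span K (Set.range (word K V)) := by
    rw [span_range_word]; trivial
  induction hx using Submodule.span_induction with
  | mem x hx =>
    obtain ⟨l, rfl⟩ := hx
    exact ⟨l.length + 1, fun n hn => contract_pow_word f hf n l hn⟩
  | zero => exact ⟨0, fun n _ => map_zero _⟩
  | add x y _ _ hx hy =>
    obtain ⟨r, hr⟩ := hx
    obtain ⟨s, hs⟩ := hy
    exact ⟨max r s, fun n hn => by rw [map_add, hr n (by omega), hs n (by omega), add_zero]⟩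
  | smul c x _ hx =>
    obtain ⟨r, hr⟩ := hx
    exact ⟨r, fun n hn => by rw [map_smul, hr n hn, smul_zero]⟩

/-- The only group-like element of the tensor coalgebra is `1`: contraction with a linear form `f`
that vanishes at `1` is locally nilpotent, and it multiplies a group-like element `g` by `f g`. -/
theorem eq_one_of_comul_eq {g : TensorCoalgebra K V}
    (hg : Coalgebra.comul (R := K) g = g ⊗ₜ[K] g) (hε : Coalgebra.counit (R := K) g = 1) :
    g = 1 := by
  have key : ∀ f : TensorCoalgebra K V →ₗ[K] K, f 1 = 0 → f g = 0 := by
    intro f hf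
    have h1 : ∀ n, ((contract f) ^ n) g = (f g) ^ n • g := by
      intro n
      induction n with
      | zero => simp
      | succ n ih =>
        rw [pow_succ', Module.End.mul_apply, ih, map_smul]
        simp [contract, hg, smul_smul, pow_succ]
    obtain ⟨r, hr⟩ := exists_contract_pow_eq_zero f hf g
    have h2 := hr r le_rfl
    rw [h1] at h2
    rcases smul_eq_zero.1 h2 with h | h
    · exact eq_zero_of_pow_eq_zero h
    · rw [h, map_zero]
  have hmem : g ∈ Submodule.span K {(1 : TensorCoalgebra K V)} := by
    by_contra hne
    obtain ⟨f, hfg, hf⟩ := Submodule.exists_dual_map_eq_bot_of_notMem hne inferInstance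
    refine hfg (key f ?_)
    have : f 1 ∈ (Submodule.span K {(1 : TensorCoalgebra K V)}).map f :=
      Submodule.mem_map_of_mem (Submodule.mem_span_singleton_self _)
    rwa [hf, Submodule.mem_bot] at this
  obtain ⟨c, rfl⟩ := Submodule.mem_span_singleton.1 hmem
  rw [map_smul, counit_one, smul_eq_mul, mul_one] at hε
  rw [hε, one_smul]

/-- The projection of the tensor coalgebra onto its summand `V`. -/
noncomputable def letter : TensorCoalgebra K V →ₗ[K] V := TensorAlgebra.ιInv

theorem letter_one : letter (1 : TensorCoalgebra K V) = 0 := by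
  let _ : Module Kᵐᵒᵖ V := Module.compHom _ ((RingHom.id K).fromOpposite mul_comm)
  have _ : IsCentralScalar K V := ⟨fun _ _ => rfl⟩
  exact congrArg TrivSqZeroExt.snd (map_one (TensorAlgebra.toTrivSqZeroExt (R := K) (M := V)))

@[simp]
theorem letter_ι (v : V) : letter (TensorAlgebra.ι K v : TensorCoalgebra K V) = v :=
  TensorAlgebra.ι_leftInverse v

theorem letter_ι_mul (v : V) (x : TensorCoalgebra K V) :
    letter (TensorAlgebra.ι K v * x : TensorCoalgebra K V) = Coalgebra.counit (R := K) x • v := by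
  induction x using induction_left with
  | h1 => rw [mul_one, letter_ι, counit_one, one_smul]
  | hsmul c x hx => rw [mul_smul_comm, map_smul, hx, map_smul, smul_assoc]
  | hadd x y hx hy => rw [mul_add, map_add, hx, hy, map_add, add_smul]
  | hmul w x hx =>
    rw [counit_mul, counit_ι, zero_mul, zero_smul]
    simp [letter, TensorAlgebra.ιInv]

theorem letter_word (l : List V) (hl : 2 ≤ l.length) : letter (word K V l) = 0 := by
  match l, hl with
  | v :: w :: l, _ =>
    rw [word_cons, letter_ι_mul, word_cons, counit_mul, counit_ι, zero_mul, zero_smul]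

/-- Splitting off the first letter of a word and putting it back: the convolution product of the
projection onto `V` and the identity is the identity on words of positive length. -/
theorem letter_convolution (x : TensorCoalgebra K V) :
    LinearMap.mul' K (TensorAlgebra K V) ((TensorAlgebra.ι K ∘ₗ letter).rTensor _
      (Coalgebra.comul (R := K) x)) = x - algebraMap K _ (Coalgebra.counit (R := K) x) := by
  induction x using induction_left with
  | h1 => rw [comul_one, counit_one]; simp [letter_one]
  | hsmul c x hx =>
    rw [map_smul, map_smul, map_smul, hx, map_smul, smul_eq_mul, map_mul, smul_sub,
      Algebra.smul_def c (algebraMap K _ _)]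
  | hadd x y hx hy => simp only [map_add, hx, hy]; abel
  | hmul v x _ =>
    have h : ∀ t : TensorAlgebra K V ⊗[K] TensorAlgebra K V,
        LinearMap.mul' K (TensorAlgebra K V) ((TensorAlgebra.ι K ∘ₗ letter).rTensor _
          ((LinearMap.mulLeft K (TensorAlgebra.ι K v)).rTensor _ t)) =
        TensorAlgebra.ι K v * TensorProduct.lid K _ ((Coalgebra.counit (R := K)
          (A := TensorCoalgebra K V)).rTensor _ t) := by
      intro t
      induction t using TensorProduct.induction_on with
      | zero => simp
      | add s t hs ht => simp only [map_add, hs, ht, mul_add]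
      | tmul a b => simp [letter_ι_mul]
    rw [comul_ι_mul, map_add, map_add, h, Coalgebra.rTensor_counit_comul, counit_mul, counit_ι]
    simp [letter_one]

/-- The unital infinitesimal relation between deconcatenation and concatenation. -/
theorem comul_mul_eq (x y : TensorCoalgebra K V) : Coalgebra.comul (R := K) (x * y) =
    (LinearMap.mulLeft K x).rTensor _ (Coalgebra.comul (R := K) y) +
      (LinearMap.mulRight K y).lTensor _ (Coalgebra.comul (R := K) x) - x ⊗ₜ[K] y := by
  induction x using induction_left with
  | h1 => simp [comul_one, LinearMap.mulLeft_one]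
  | hsmul c x hx =>
    have h : LinearMap.mulLeft K (c • x) = c • LinearMap.mulLeft K x := by ext; simp
    rw [smul_mul_assoc, map_smul, hx, h, map_smul, map_smul, LinearMap.rTensor_smul,
      smul_sub, smul_add, TensorProduct.smul_tmul', LinearMap.smul_apply]
  | hadd x x' hx hx' =>
    have h : LinearMap.mulLeft K (x + x') = LinearMap.mulLeft K x + LinearMap.mulLeft K x' := by
      ext; simp [add_mul]
    rw [add_mul, map_add, hx, hx', h, map_add, map_add, LinearMap.rTensor_add,
      TensorProduct.add_tmul, LinearMap.add_apply]
    abel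
  | hmul v x hx =>
    have h : ∀ t : TensorAlgebra K V ⊗[K] TensorAlgebra K V,
        (LinearMap.mulLeft K (TensorAlgebra.ι K v)).rTensor _
          ((LinearMap.mulRight K y).lTensor _ t) = (LinearMap.mulRight K y).lTensor _
          ((LinearMap.mulLeft K (TensorAlgebra.ι K v)).rTensor _ t) := by
      intro t
      rw [← LinearMap.comp_apply, ← LinearMap.comp_apply, LinearMap.rTensor_comp_lTensor,
        LinearMap.lTensor_comp_rTensor]
    rw [mul_assoc, comul_ι_mul, hx, comul_ι_mul, map_sub, map_add, map_add, h,
      LinearMap.mulLeft_mul, LinearMap.rTensor_comp]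
    simp only [LinearMap.comp_apply, LinearMap.rTensor_tmul, LinearMap.lTensor_tmul,
      LinearMap.mulLeft_apply, LinearMap.mulRight_apply, mul_assoc]
    abel

end TensorCoalgebra

/-! ### The coalgebra map from the tensor coalgebra -/

section Dot

variable {K A : Type*} [CommRing K] [Ring A] [Algebra K A] [TwoAssociativeAlgebra K A]

@[simp]
theorem dotProd_nil : dotProd K ([] : List A) = 1 := rfl

@[simp]
theorem dotProd_cons (x : A) (l : List A) :
    dotProd K (x :: l) = dot (K := K) x (dotProd K l) := rfl

theorem dotProd_append (l l' : List A) :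
    dotProd K (l ++ l') = dot (K := K) (dotProd K l) (dotProd K l') := by
  induction l with
  | nil => simp [one_dot]
  | cons x l ih => simp [ih, dot_assoc]

theorem dot_one_left : dot (K := K) (1 : A) = LinearMap.id := LinearMap.ext one_dot

/-- Left multiplication by a primitive element for the second product is compatible with the
coproduct in the same way as adjoining a first letter is with deconcatenation. -/
theorem IsTwoAssociativeBialgebra.comul_dot_of_mem_Prim [Coalgebra K A]
    (h : IsTwoAssociativeBialgebra K A) {p : A} (hp : p ∈ Prim K A) (x : A) :
    Coalgebra.comul (R := K) (dot (K := K) p x) = 1 ⊗ₜ dot (K := K) p x +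
      (dot (K := K) p).rTensor A (Coalgebra.comul (R := K) x) := by
  have hm : ∀ t : A ⊗[K] A, TensorProduct.map₂ (dot (K := K)) (dot (K := K)) (p ⊗ₜ[K] (1 : A)) t =
      (dot (K := K) p).rTensor A t := by
    intro t
    rw [TensorProduct.map₂_apply_tmul, dot_one_left]
    rfl
  rw [h.comul_dot, hm, mem_Prim.1 hp]
  simp [TensorProduct.map₂_apply_tmul, one_dot, dot_one]
  abel

end Dot

section DotLift

variable {K A V : Type*} [CommRing K] [Ring A] [Algebra K A] [TwoAssociativeAlgebra K A]
  [AddCommGroup V] [Module K V]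

/-- The linear map `T(V) → A` that extends `g : V → A` and takes words to products for the second
product. -/
noncomputable def dotLift (g : V →ₗ[K] A) : TensorCoalgebra K V →ₗ[K] A :=
  LinearMap.applyₗ (1 : A) ∘ₗ (TensorAlgebra.lift K
    ((dot (K := K) : A →ₗ[K] Module.End K A) ∘ₗ g)).toLinearMap

@[simp]
theorem dotLift_one (g : V →ₗ[K] A) : dotLift g 1 = 1 := by simp [dotLift]

@[simp]
theorem dotLift_ι_mul (g : V →ₗ[K] A) (v : V) (x : TensorCoalgebra K V) :
    dotLift g (TensorAlgebra.ι K v * x) = dot (K := K) (g v) (dotLift g x) := by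
  simp [dotLift]

@[simp]
theorem dotLift_ι (g : V →ₗ[K] A) (v : V) : dotLift g (TensorAlgebra.ι K v) = g v := by
  simpa [dot_one] using dotLift_ι_mul g v 1

theorem dotLift_word (g : V →ₗ[K] A) (l : List V) :
    dotLift g (TensorCoalgebra.word K V l) = dotProd K (l.map g) := by
  induction l with
  | nil => simp [TensorCoalgebra.word]
  | cons v l ih =>
    have h : TensorCoalgebra.word K V (v :: l) =
        TensorAlgebra.ι K v * TensorCoalgebra.word K V l := by simp [TensorCoalgebra.word]
    rw [h, dotLift_ι_mul, ih, List.map_cons, dotProd_cons]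

theorem dotLift_mul (g : V →ₗ[K] A) (x y : TensorCoalgebra K V) :
    dotLift g (x * y) = dot (K := K) (dotLift g x) (dotLift g y) := by
  induction x using TensorCoalgebra.induction_left with
  | h1 => simp [one_dot]
  | hsmul c x hx => simp [hx]
  | hadd x x' hx hx' => simp [add_mul, hx, hx']
  | hmul v x hx => rw [mul_assoc, dotLift_ι_mul, hx, dotLift_ι_mul, dot_assoc]

end DotLift

section CoalgHom

variable {K A V : Type*} [Field K] [Ring A] [Algebra K A] [Coalgebra K A]
  [TwoAssociativeAlgebra K A] [AddCommGroup V] [Module K V]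

/-- `dotLift g` as a coalgebra map, for a map `g` with primitive values. -/
noncomputable def dotLiftHom (h : IsTwoAssociativeBialgebra K A) (g : V →ₗ[K] A)
    (hg : ∀ v, g v ∈ Prim K A) : TensorCoalgebra K V →ₗc[K] A :=
  { dotLift g with
    counit_comp := by
      ext1 x
      change Coalgebra.counit (R := K) (dotLift g x) = Coalgebra.counit (R := K) x
      induction x using TensorCoalgebra.induction_left with
      | h1 => rw [dotLift_one, h.counit_one, TensorCoalgebra.counit_one]
      | hsmul c x hx => simp only [map_smul, hx]
      | hadd x y hx hy => simp only [map_add, hx, hy]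
      | hmul v x hx =>
        rw [TensorCoalgebra.counit_mul, TensorCoalgebra.counit_ι, zero_mul]
        -- Under `id ⊗ ε`, the formula for `Δ(p · y)` becomes
        -- `(p · y) ⊗ 1 = 1 ⊗ ε(p · y) + (p · y) ⊗ 1`, so `ε(p · y) = 0`.
        have hε : ∀ p y : A, p ∈ Prim K A → Coalgebra.counit (R := K) (dot (K := K) p y) = 0 := by
          intro p y hp
          have e := Coalgebra.lTensor_counit_comul (R := K) (dot (K := K) p y)
          rw [h.comul_dot_of_mem_Prim hp, map_add, ← LinearMap.comp_apply (LinearMap.lTensor _ _),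
            LinearMap.lTensor_comp_rTensor, ← LinearMap.rTensor_comp_lTensor, LinearMap.comp_apply,
            Coalgebra.lTensor_counit_comul] at e
          simp only [LinearMap.lTensor_tmul, LinearMap.rTensor_tmul] at e
          have e' := congrArg (fun t => Coalgebra.counit (R := K) (TensorProduct.rid K A t)) e
          simpa [h.counit_one] using e'
        rw [dotLift_ι_mul, hε _ _ (hg v)]
    map_comp_comul := by
      ext1 x
      change TensorProduct.map (dotLift g) (dotLift g) (Coalgebra.comul (R := K) x) =
        Coalgebra.comul (R := K) (dotLift g x)
      induction x using TensorCoalgebra.induction_left with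
      | h1 => rw [dotLift_one, h.comul_one, TensorCoalgebra.comul_one]; simp
      | hsmul c x hx => simp only [map_smul, hx]
      | hadd x y hx hy => simp only [map_add, hx, hy]
      | hmul v x hx =>
        rw [TensorCoalgebra.comul_ι_mul, dotLift_ι_mul, h.comul_dot_of_mem_Prim (hg v), ← hx,
          map_add]
        congr 1
        · simp
        · have e : dotLift g ∘ₗ LinearMap.mulLeft K (TensorAlgebra.ι K v) =
              dot (K := K) (g v) ∘ₗ dotLift g := LinearMap.ext fun y => by simp
          rw [← LinearMap.comp_apply, LinearMap.map_comp_rTensor, e, ← LinearMap.rTensor_comp_map,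
            LinearMap.comp_apply] }

@[simp]
theorem dotLiftHom_apply (h : IsTwoAssociativeBialgebra K A) (g : V →ₗ[K] A)
    (hg : ∀ v, g v ∈ Prim K A) (x : TensorCoalgebra K V) : dotLiftHom h g hg x = dotLift g x := rfl

end CoalgHom

namespace TensorCoalgebra

variable {K A V : Type*} [Field K] [Ring A] [Algebra K A] [Coalgebra K A]
  [AddCommGroup V] [Module K V]

/-- An element of the tensor coalgebra with zero reduced coproduct lies in `K ⊕ V`. -/
theorem eq_of_reducedComul_eq_zero {x : TensorCoalgebra K V}
    (hx : reducedComul K (TensorCoalgebra K V) x = 0) :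
    x = TensorAlgebra.ι K (letter x) + algebraMap K _ (Coalgebra.counit (R := K) x) := by
  have h : Coalgebra.comul (R := K) x = x ⊗ₜ[K] 1 + 1 ⊗ₜ[K] x :=
    mem_Prim.1 (mem_Prim_iff_reducedComul.2 hx)
  have h2 := letter_convolution x
  rw [h] at h2
  simp only [map_add, LinearMap.rTensor_tmul, LinearMap.comp_apply, letter_one, map_zero,
    TensorProduct.zero_tmul, add_zero, LinearMap.mul'_apply, mul_one] at h2
  rw [h2, sub_add_cancel]

/-- A unital coalgebra map from the tensor coalgebra that is injective on letters is injective: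
if `f` is injective on `F n` and kills `x ∈ F (n + 1)`, then the reduced coproduct of `x` vanishes,
since over a field `f ⊗ f` is injective on `F n ⊗ F n`. -/
theorem injective_of_injective_ι (f : TensorCoalgebra K V →ₗc[K] A) (hf : f 1 = 1)
    (h1 : Coalgebra.counit (R := K) (1 : A) = 1)
    (hi : Function.Injective fun v => f (TensorAlgebra.ι K v)) : Function.Injective f := by
  have one_ne : (1 : A) ≠ 0 := fun h => by simp [h] at h1
  have hc : ∀ x : TensorCoalgebra K V,
      Coalgebra.counit (R := K) (f x) = Coalgebra.counit (R := K) x :=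
    fun x => CoalgHomClass.counit_comp_apply f x
  have key : ∀ n, ∀ x ∈ coradicalFiltration K (TensorCoalgebra K V) n, f x = 0 → x = 0 := by
    intro n
    induction n with
    | zero =>
      intro x hx hfx
      obtain ⟨c, rfl⟩ := Submodule.mem_span_singleton.1 hx
      rw [map_smul, hf] at hfx
      rw [(smul_eq_zero.1 hfx).resolve_right one_ne, zero_smul]
    | succ n ih =>
      intro x hx hfx
      obtain ⟨t, ht⟩ := mem_coradicalFiltration_succ.1 hx
      obtain ⟨s, hs⟩ := ((f : TensorCoalgebra K V →ₗ[K] A) ∘ₗ (coradicalFiltration K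
        (TensorCoalgebra K V) n).subtype).exists_leftInverse_of_injective
        (LinearMap.ker_eq_bot'.2 fun y hy => Subtype.ext (ih y y.2 hy))
      have h2 : reducedComul K (TensorCoalgebra K V) x = 0 := by
        have h3 := reducedComul_map f hf x
        rw [hfx, map_zero, ← ht, TensorProduct.mapIncl, ← LinearMap.comp_apply,
          ← TensorProduct.map_comp] at h3
        have h4 := congrArg (TensorProduct.map s s) h3
        rw [← LinearMap.comp_apply, ← TensorProduct.map_comp, hs, TensorProduct.map_id,
          map_zero] at h4
        rw [← ht, show t = 0 by simpa using h4.symm, map_zero]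
      have h5 := eq_of_reducedComul_eq_zero h2
      have h6 : Coalgebra.counit (R := K) x = 0 := by rw [← hc, hfx, map_zero]
      rw [h6, map_zero, add_zero] at h5
      have h7 : letter x = 0 := hi (by
        change f (TensorAlgebra.ι K (letter x)) = f (TensorAlgebra.ι K 0)
        rw [← h5, hfx, map_zero, map_zero])
      rw [h5, h7, map_zero]
  refine (injective_iff_map_eq_zero f).2 fun x hx => ?_
  obtain ⟨n, hn⟩ := isConnected x
  exact key n x hn hx

end TensorCoalgebra

/-! ### Connected 2-associative bialgebras are cofree -/

section Structure

variable {K A : Type*} [Field K] [Ring A] [Algebra K A] [Coalgebra K A]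
  [TwoAssociativeAlgebra K A]

/-- The convolution product `x ↦ e(x₍₁₎) · x₍₂₎` of a map `e` with the identity, with respect to the
second product. -/
noncomputable def convId (e : A →ₗ[K] A) : A →ₗ[K] A :=
  TensorProduct.lift (dot (K := K)) ∘ₗ e.rTensor A ∘ₗ Coalgebra.comul

theorem convId_apply (e : A →ₗ[K] A) (x : A) : convId e x =
    TensorProduct.lift (dot (K := K)) (e.rTensor A (Coalgebra.comul (R := K) x)) := rfl

theorem comul_convId (h : IsTwoAssociativeBialgebra K A) {e : A →ₗ[K] A}
    (he : ∀ x, e x ∈ Prim K A) (x : A) : Coalgebra.comul (R := K) (convId e x) =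
      1 ⊗ₜ convId e x + (convId e).rTensor A (Coalgebra.comul (R := K) x) := by
  have h1 : ∀ t : A ⊗[K] A, Coalgebra.comul (R := K) (lift (dot (K := K)) (e.rTensor A t)) =
      1 ⊗ₜ lift (dot (K := K)) (e.rTensor A t) +
        (lift (dot (K := K)) ∘ₗ e.rTensor A).rTensor A ((TensorProduct.assoc K A A A).symm
          ((Coalgebra.comul (R := K)).lTensor A t)) := by
    intro t
    induction t using TensorProduct.induction_on with
    | zero => simp
    | add s t hs ht => simp only [map_add, hs, ht, tmul_add]; abel
    | tmul a b =>
      rw [LinearMap.rTensor_tmul, lift.tmul, h.comul_dot_of_mem_Prim (he a),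
        LinearMap.lTensor_tmul]
      congr 1
      generalize (Coalgebra.comul (R := K) b : A ⊗[K] A) = u
      induction u using TensorProduct.induction_on with
      | zero => simp
      | add s t hs ht => simp only [map_add, hs, ht, tmul_add]
      | tmul c d => simp
  rw [convId_apply, h1, Coalgebra.coassoc_symm_apply, ← LinearMap.rTensor_comp_apply]
  rfl

/-- On the image of the tensor coalgebra, `convId e` removes the first letter of a word and puts it
back. -/
theorem convId_dotLift (h : IsTwoAssociativeBialgebra K A) {e : A →ₗ[K] Prim K A}
    (he : ∀ y, e (dotLift (Prim K A).subtype y) = TensorCoalgebra.letter y)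
    (y : TensorCoalgebra K (Prim K A)) :
    convId ((Prim K A).subtype ∘ₗ e) (dotLift (Prim K A).subtype y) =
      dotLift (Prim K A).subtype y - algebraMap K A (Coalgebra.counit (R := K) y) := by
  have h1 := CoalgHomClass.map_comp_comul_apply (dotLiftHom h (Prim K A).subtype subtype_mem_Prim) y
  have h2 : ∀ t : TensorCoalgebra K (Prim K A) ⊗[K] TensorCoalgebra K (Prim K A),
      lift (dot (K := K)) (((Prim K A).subtype ∘ₗ e).rTensor A
        (TensorProduct.map (dotLift (Prim K A).subtype) (dotLift (Prim K A).subtype) t)) =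
      dotLift (Prim K A).subtype (LinearMap.mul' K (TensorAlgebra K (Prim K A))
        ((TensorAlgebra.ι K ∘ₗ TensorCoalgebra.letter).rTensor _ t)) := by
    intro t
    induction t using TensorProduct.induction_on with
    | zero => simp
    | add s t hs ht => simp only [map_add, hs, ht]
    | tmul a b => simp [he]
  have h3 : Coalgebra.comul (R := K) (dotLift (Prim K A).subtype y) =
      TensorProduct.map (dotLift (Prim K A).subtype) (dotLift (Prim K A).subtype)
        (Coalgebra.comul (R := K) y) := h1.symm
  rw [convId_apply, h3, h2, TensorCoalgebra.letter_convolution, map_sub,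
    Algebra.algebraMap_eq_smul_one, map_smul, dotLift_one, Algebra.algebraMap_eq_smul_one]

theorem dotLift_subtype_injective (h : IsTwoAssociativeBialgebra K A) :
    Function.Injective (dotLift (K := K) (Prim K A).subtype) :=
  TensorCoalgebra.injective_of_injective_ι (dotLiftHom h (Prim K A).subtype subtype_mem_Prim)
    (dotLift_one _) h.counit_one (fun v w hvw => Subtype.ext <|
      (dotLift_ι _ v).symm.trans (hvw.trans (dotLift_ι _ w)))

theorem exists_retraction (h : IsTwoAssociativeBialgebra K A) : ∃ e : A →ₗ[K] Prim K A,
    ∀ y, e (dotLift (Prim K A).subtype y) = TensorCoalgebra.letter y := by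
  obtain ⟨s, hs⟩ := (dotLift (K := K) (Prim K A).subtype).exists_leftInverse_of_injective
    (LinearMap.ker_eq_bot.2 (dotLift_subtype_injective h))
  exact ⟨TensorCoalgebra.letter ∘ₗ s, fun y => congrArg TensorCoalgebra.letter (LinearMap.congr_fun hs y)⟩

/-- Products of primitive elements span a connected 2-associative bialgebra. Let `e` be a retraction
onto the primitive elements that extends the projection of words onto letters. If `F n` consists of
combinations of products of primitive elements and `x ∈ F (n + 1)`, then
`x - e(x₍₁₎) · x₍₂₎ - ε(x) 1` is primitive, and the middle term is such a combination as well. -/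
theorem dotLift_subtype_surjective (h : IsTwoAssociativeBialgebra K A) (hc : IsConnected K A) :
    Function.Surjective (dotLift (K := K) (Prim K A).subtype) := by
  obtain ⟨e, he⟩ := exists_retraction h
  have he1 : e 1 = 0 := by
    have := he 1
    rwa [dotLift_one, TensorCoalgebra.letter_one] at this
  have hε : ∀ y, Coalgebra.counit (R := K) (dotLift (Prim K A).subtype y) =
      Coalgebra.counit (R := K) y := fun y =>
    CoalgHomClass.counit_comp_apply (dotLiftHom h (Prim K A).subtype subtype_mem_Prim) y
  set E : A →ₗ[K] A := (Prim K A).subtype ∘ₗ e with hE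
  have hEP : ∀ x, E x ∈ Prim K A := fun x => (e x).2
  have hE1 : E 1 = 0 := by simp [hE, he1]
  have hD1 : convId E 1 = 0 := by simp [convId_apply, h.comul_one, hE1]
  suffices key : ∀ n, ∀ x ∈ coradicalFiltration K A n,
      x ∈ LinearMap.range (dotLift (K := K) (Prim K A).subtype) by
    intro x
    obtain ⟨n, hn⟩ := hc x
    exact key n x hn
  intro n
  induction n with
  | zero =>
    intro x hx
    obtain ⟨c, rfl⟩ := Submodule.mem_span_singleton.1 hx
    exact ⟨c • 1, by simp⟩
  | succ n ih =>
    intro x hx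
    obtain ⟨t, ht⟩ := mem_coradicalFiltration_succ.1 hx
    set ε : A →ₗ[K] K := Coalgebra.counit with hεdef
    have hΔ : Coalgebra.comul (R := K) x = reducedComul K A x + x ⊗ₜ 1 + 1 ⊗ₜ x := by
      rw [reducedComul_apply]; abel
    -- On the left factor of the reduced coproduct, `convId E` is the identity minus the counit.
    have hD : (convId E).rTensor A (reducedComul K A x) =
        reducedComul K A x + ε x • (1 ⊗ₜ 1) := by
      have h1 : (convId E).rTensor A (reducedComul K A x) = reducedComul K A x -
          TensorProduct.mk K A A 1 (TensorProduct.lid K A (ε.rTensor A (reducedComul K A x))) := by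
        rw [← ht]
        clear ht
        induction t using TensorProduct.induction_on with
        | zero => simp
        | add s t hs ht => simp only [map_add, hs, ht]; abel
        | tmul a b =>
          obtain ⟨y, hy⟩ := ih a a.2
          have h2 : convId E (a : A) = a - algebraMap K A (ε a) := by
            rw [← hy, hεdef, hε]
            exact convId_dotLift h he y
          simp [mapIncl, h2, sub_tmul, Algebra.algebraMap_eq_smul_one, smul_tmul']
      have h3 : ε.rTensor A (Coalgebra.comul (R := K) x) = 1 ⊗ₜ x :=
        Coalgebra.rTensor_counit_comul x
      rw [h1, reducedComul_apply]
      simp only [map_sub, h3]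
      simp [hεdef, h.counit_one]
    have hp : x - convId E x - ε x • 1 ∈ Prim K A := by
      rw [mem_Prim, map_sub, map_sub, comul_convId h hEP, hΔ, map_add, map_add, hD, map_smul,
        h.comul_one]
      simp only [LinearMap.rTensor_tmul, hD1, zero_tmul, sub_tmul, tmul_sub, smul_tmul', tmul_smul]
      abel
    have hr : convId E x ∈ LinearMap.range (dotLift (K := K) (Prim K A).subtype) := by
      have hP : ∀ p b, b ∈ LinearMap.range (dotLift (K := K) (Prim K A).subtype) →
          dot (K := K) (E p) b ∈ LinearMap.range (dotLift (K := K) (Prim K A).subtype) := by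
        rintro p _ ⟨y, rfl⟩
        exact ⟨TensorAlgebra.ι K (e p) * y, by simp [hE]⟩
      rw [convId_apply, hΔ, ← ht, map_add, map_add, map_add, map_add]
      refine add_mem (add_mem ?_ ?_) ?_
      · clear ht
        induction t using TensorProduct.induction_on with
        | zero => simp
        | add s t hs ht => simpa only [map_add] using add_mem hs ht
        | tmul a b => simpa [mapIncl] using hP a b (ih b b.2)
      · simpa using hP x 1 ⟨1, dotLift_one _⟩
      · simp [hE1]
    have hx' : x = (x - convId E x - ε x • 1) + convId E x + ε x • 1 := by abel
    rw [hx']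
    refine add_mem (add_mem ⟨TensorAlgebra.ι K ⟨_, hp⟩, by simp⟩ hr) ⟨ε x • 1, by simp⟩

theorem dotLift_subtype_bijective (h : IsTwoAssociativeBialgebra K A) (hc : IsConnected K A) :
    Function.Bijective (dotLift (K := K) (Prim K A).subtype) :=
  ⟨dotLift_subtype_injective h, dotLift_subtype_surjective h hc⟩

theorem exists_coalgEquiv (h : IsTwoAssociativeBialgebra K A) (hc : IsConnected K A) :
    Nonempty (A ≃ₗc[K] TensorCoalgebra K (Prim K A)) :=
  ⟨(CoalgEquiv.ofBijective (f := dotLiftHom h (Prim K A).subtype subtype_mem_Prim)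
    (dotLift_subtype_bijective h hc)).symm⟩

end Structure

/-! ### Cofree bialgebras are connected and carry a second product -/

section Cofree

variable {K H : Type*} [Field K] [Ring H] [Bialgebra K H]

theorem coalgEquiv_one {V : Type*} [AddCommGroup V] [Module K V]
    (f : H ≃ₗc[K] TensorCoalgebra K V) : f 1 = 1 := by
  refine TensorCoalgebra.eq_one_of_comul_eq ?_ ?_
  · rw [← CoalgHomClass.map_comp_comul_apply f, Bialgebra.comul_one]
    rfl
  · rw [CoalgHomClass.counit_comp_apply f, Bialgebra.counit_one]

theorem IsCofree.isConnected (h : IsCofree K H) : IsConnected K H := by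
  obtain ⟨f⟩ := h
  refine IsConnected.of_surjective (f.symm : TensorCoalgebra K (Prim K H) →ₗc[K] H) ?_
    f.symm.surjective TensorCoalgebra.isConnected
  rw [← coalgEquiv_one f]
  exact f.symm_apply_apply 1

/-- The concatenation product, transported along a coalgebra isomorphism. -/
theorem IsCofree.exists_isTwoAssociativeBialgebra (h : IsCofree K H) :
    ∃ _ : TwoAssociativeAlgebra K H, IsTwoAssociativeBialgebra K H := by
  obtain ⟨f⟩ := h
  have f1 := coalgEquiv_one f
  have fs : ∀ x, f (f.symm x) = x := f.apply_symm_apply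
  let d : H →ₗ[K] H →ₗ[K] H :=
    ((LinearMap.mul K (TensorAlgebra K (Prim K H))).compl₁₂ (f : H →ₗ[K] _) (f : H →ₗ[K] _)).compr₂
      (f.symm : TensorCoalgebra K (Prim K H) →ₗ[K] H)
  have hd : ∀ x y, d x y = f.symm (f x * f y) := fun x y => rfl
  let T : TwoAssociativeAlgebra K H :=
    { dot := d
      dot_assoc := fun x y z => by simp only [hd, fs, mul_assoc]
      one_dot := fun x => by rw [hd, f1, one_mul]; exact f.symm_apply_apply x
      dot_one := fun x => by rw [hd, f1, mul_one]; exact f.symm_apply_apply x }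
  refine ⟨T, Bialgebra.counit_one, Bialgebra.counit_mul, Bialgebra.comul_one, Bialgebra.comul_mul,
    fun x y => ?_⟩
  change Coalgebra.comul (R := K) (d x y) = map₂ d d _ _ + map₂ d d _ _ - _
  have hinj : Function.Injective (TensorProduct.map (f : H →ₗ[K] TensorCoalgebra K (Prim K H))
      (f : H →ₗ[K] TensorCoalgebra K (Prim K H))) := fun s t hst =>
    (TensorProduct.congr f.toLinearEquiv f.toLinearEquiv).injective hst
  apply hinj
  have hΔ : ∀ z, TensorProduct.map (f : H →ₗ[K] TensorCoalgebra K (Prim K H))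
      (f : H →ₗ[K] TensorCoalgebra K (Prim K H)) (Coalgebra.comul (R := K) z) =
      Coalgebra.comul (R := K) (f z) := CoalgHomClass.map_comp_comul_apply f
  have h1 : ∀ t : H ⊗[K] H, TensorProduct.map (f : H →ₗ[K] TensorCoalgebra K (Prim K H))
      (f : H →ₗ[K] TensorCoalgebra K (Prim K H)) (map₂ d d (x ⊗ₜ[K] (1 : H)) t) =
      (LinearMap.mulLeft K (f x)).rTensor _ (TensorProduct.map
        (f : H →ₗ[K] TensorCoalgebra K (Prim K H)) (f : H →ₗ[K] TensorCoalgebra K (Prim K H)) t) := by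
    intro t
    induction t using TensorProduct.induction_on with
    | zero => simp
    | add s t hs ht => simp only [map_add, hs, ht]
    | tmul a b => simp [hd, f1, fs]
  have h2 : ∀ t : H ⊗[K] H, TensorProduct.map (f : H →ₗ[K] TensorCoalgebra K (Prim K H))
      (f : H →ₗ[K] TensorCoalgebra K (Prim K H)) (map₂ d d t ((1 : H) ⊗ₜ[K] y)) =
      (LinearMap.mulRight K (f y)).lTensor _ (TensorProduct.map
        (f : H →ₗ[K] TensorCoalgebra K (Prim K H)) (f : H →ₗ[K] TensorCoalgebra K (Prim K H)) t) := by
    intro t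
    induction t using TensorProduct.induction_on with
    | zero => simp
    | add s t hs ht => simp only [map_add, LinearMap.add_apply, hs, ht]
    | tmul a b => simp [hd, f1, fs]
  rw [hΔ, map_sub, map_add, h1, h2, hΔ, hΔ, hd, fs, TensorCoalgebra.comul_mul_eq]
  rfl

end Cofree

/-! ### Sums over blockings -/

section BlockProdSum

variable {K A : Type*} [CommRing K] [Ring A] [Algebra K A] [TwoAssociativeAlgebra K A]
  {α β : Type*}

theorem blockings_map (g : α → β) (k : ℕ) (u v : List α) :
    blockings k (u.map g) (v.map g) =
      (blockings k u v).map fun π => π.map fun b => (b.1.map g, b.2.map g) := by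
  induction k generalizing u v with
  | zero => cases u <;> cases v <;> simp [blockings]
  | succ k ih =>
    simp only [blockings, List.length_map, ← List.map_drop, ← List.map_take, ih, List.map_flatMap,
      List.map_map]
    rfl

theorem blockings_eq_nil {k : ℕ} {u v : List α} (h : u.length + v.length < k) :
    blockings k u v = [] := by
  induction k generalizing u v with
  | zero => omega
  | succ k ih =>
    simp only [blockings, List.flatMap_eq_nil_iff, List.map_eq_nil_iff, List.mem_filter,
      List.mem_product, List.mem_range, decide_eq_true_eq, Prod.forall, Prod.mk.injEq, ne_eq]
    rintro i j ⟨⟨hi, hj⟩, hij⟩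
    apply ih
    simp only [List.length_drop]
    omega

variable (K) in
/-- The sum of the products `f(u⁽¹⁾, v⁽¹⁾) · … · f(u⁽ᵏ⁾, v⁽ᵏ⁾)` over all cuttings of `(u, v)` into `k`
pairs of blocks. -/
def blockProdSum (f : List α → List α → A) (k : ℕ) (u v : List α) : A :=
  ((blockings k u v).map fun π => dotProd K (π.map fun b => f b.1 b.2)).sum

theorem blockProdSum_map (g : α → β) (f : List β → List β → A) (k : ℕ) (u v : List α) :
    blockProdSum K f k (u.map g) (v.map g) =
      blockProdSum K (fun u v => f (u.map g) (v.map g)) k u v := by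
  simp only [blockProdSum, blockings_map, List.map_map]
  congr 1
  refine List.map_congr_left fun π _ => ?_
  simp [Function.comp_def]

theorem blockProdSum_zero (f : List α → List α → A) {u v : List α} (h : 0 < u.length + v.length) :
    blockProdSum K f 0 u v = 0 := by
  cases u <;> cases v <;> simp [blockProdSum, blockings] at h ⊢

@[simp]
theorem blockProdSum_zero_nil_nil (f : List α → List α → A) :
    blockProdSum K f 0 [] [] = 1 := by
  simp [blockProdSum, blockings]

theorem blockProdSum_eq_zero (f : List α → List α → A) {k : ℕ} {u v : List α}
    (h : u.length + v.length < k) : blockProdSum K f k u v = 0 := by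
  simp [blockProdSum, blockings_eq_nil h]

/-- Splitting off the first pair of blocks. -/
theorem blockProdSum_succ (f : List α → List α → A) (k : ℕ) (u v : List α) :
    blockProdSum K f (k + 1) u v =
      ∑ i ∈ Finset.range (u.length + 1), ∑ j ∈ Finset.range (v.length + 1),
        if i + j = 0 then 0 else
          dot (K := K) (f (u.take i) (v.take j)) (blockProdSum K f k (u.drop i) (v.drop j)) := by
  have h1 : ∀ (l : List (ℕ × ℕ)) (F : ℕ × ℕ → A), ((l.filter (· ≠ (0, 0))).map F).sum =
      (l.map fun ij => if ij.1 + ij.2 = 0 then 0 else F ij).sum := by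
    intro l F
    induction l with
    | nil => rfl
    | cons ij l ih =>
      by_cases h : ij = (0, 0)
      · subst h
        simpa using ih
      · have h' : ij.1 + ij.2 ≠ 0 := fun h' => h (Prod.ext (by simp; omega) (by simp; omega))
        rw [List.filter_cons_of_pos (by simpa using h)]
        simp only [List.map_cons, List.sum_cons, ih, if_neg h']
  have h2 : ∀ (L : List ℕ) (L' : List ℕ) (F : ℕ × ℕ → A), ((L ×ˢ L').map F).sum =
      (L.map fun i => (L'.map fun j => F (i, j)).sum).sum := by
    intro L L' F
    induction L with
    | nil => simp
    | cons i L ih => simp [List.product_cons, ih, Function.comp_def]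
  have h3 : ∀ (n : ℕ) (F : ℕ → A), ((List.range n).map F).sum = ∑ i ∈ Finset.range n, F i :=
    fun n F => rfl
  have h4 : ∀ (l : List (List (List α × List α))) (x : A) (G : List (List α × List α) → A),
      (l.map fun π => dot (K := K) x (G π)).sum = dot (K := K) x (l.map G).sum := by
    intro l x G
    rw [map_list_sum, List.map_map]
    rfl
  simp only [blockProdSum, blockings, List.flatMap, List.map_flatten, List.map_map,
    List.sum_flatten, Function.comp_def, List.map_cons, dotProd_cons]
  rw [h1, h2, h3]
  simp only [h3, h4]

theorem blockProdSum_one (f : List α → List α → A) {u v : List α} (h : 0 < u.length + v.length) :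
    blockProdSum K f 1 u v = f u v := by
  rw [blockProdSum_succ, Finset.sum_eq_single u.length, Finset.sum_eq_single v.length]
  · rw [if_neg (by omega), List.drop_length, List.drop_length, blockProdSum_zero_nil_nil,
      dot_one, List.take_length, List.take_length]
  · intro j hj hne
    rw [Finset.mem_range] at hj
    rw [blockProdSum_zero f (by simp; omega), map_zero, ite_self]
  · simp
  · intro i hi hne
    rw [Finset.mem_range] at hi
    refine Finset.sum_eq_zero fun j _ => ?_
    rw [blockProdSum_zero f (by simp; omega), map_zero, ite_self]
  · simp

variable (K) in
/-- The sum of `blockProdSum K f k u v` over all `k`. -/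
def totalBlockSum (f : List α → List α → A) (u v : List α) : A :=
  ∑ k ∈ Finset.range (u.length + v.length + 1), blockProdSum K f k u v

theorem totalBlockSum_eq (f : List α → List α → A) {u v : List α} {n : ℕ}
    (h : u.length + v.length < n) :
    totalBlockSum K f u v = ∑ k ∈ Finset.range n, blockProdSum K f k u v := by
  refine Finset.sum_subset (fun k hk => ?_) fun k _ hk => ?_
  · simp only [Finset.mem_range] at hk ⊢; omega
  · exact blockProdSum_eq_zero f (by simpa using hk)

theorem totalBlockSum_eq_sum_Icc_one (f : List α → List α → A) {u v : List α}
    (h : 0 < u.length + v.length) : totalBlockSum K f u v =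
      ∑ k ∈ Finset.Icc 1 (u.length + v.length), blockProdSum K f k u v := by
  rw [totalBlockSum, Finset.range_eq_Ico, Finset.sum_eq_sum_Ico_succ_bot (by omega),
    blockProdSum_zero f h, zero_add]
  rfl

theorem totalBlockSum_eq_add (f : List α → List α → A) {u v : List α}
    (h : 0 < u.length + v.length) : totalBlockSum K f u v =
      f u v + ∑ k ∈ Finset.Icc 2 (u.length + v.length), blockProdSum K f k u v := by
  rw [totalBlockSum_eq_sum_Icc_one f h, ← blockProdSum_one (K := K) f h]
  exact Finset.sum_eq_sum_Ico_succ_bot (b := u.length + v.length + 1) (by omega) _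

theorem totalBlockSum_rec (f : List α → List α → A) {u v : List α}
    (h : 0 < u.length + v.length) : totalBlockSum K f u v =
      ∑ i ∈ Finset.range (u.length + 1), ∑ j ∈ Finset.range (v.length + 1),
        if i + j = 0 then 0 else
          dot (K := K) (f (u.take i) (v.take j)) (totalBlockSum K f (u.drop i) (v.drop j)) := by
  rw [totalBlockSum, Finset.sum_range_succ', blockProdSum_zero f h, add_zero]
  simp only [blockProdSum_succ]
  rw [Finset.sum_comm]
  refine Finset.sum_congr rfl fun i hi => ?_
  rw [Finset.sum_comm]
  refine Finset.sum_congr rfl fun j hj => ?_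
  rw [Finset.mem_range] at hi hj
  by_cases hij : i + j = 0
  · simp [hij]
  · simp only [if_neg hij]
    rw [← map_sum, totalBlockSum_eq (n := u.length + v.length)]
    simp only [List.length_drop]
    omega

theorem dotProd_mul_dotProd {u v : List A} (hu : u ≠ []) (hv : v ≠ []) :
    dotProd K u * dotProd K v = totalBlockSum K (opM K) u v := by
  rw [totalBlockSum_eq_add _ (by have := List.length_pos_iff.2 hu; omega),
    opM_of_ne_nil K hu hv]
  simp [blockProdSum]

/-- The operations of a 2-associative algebra are characterized by their values on an empty word and
by the expansion of `*` in terms of `·`. -/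
theorem opM_map_eq (g : α → A) (F : List α → List α → A) (h00 : F [] [] = 0)
    (h10 : ∀ x, F [x] [] = g x) (h01 : ∀ x, F [] [x] = g x)
    (hl : ∀ u : List α, 2 ≤ u.length → F u [] = 0) (hr : ∀ v : List α, 2 ≤ v.length → F [] v = 0)
    (hmul : ∀ u v, u ≠ [] → v ≠ [] →
      dotProd K (u.map g) * dotProd K (v.map g) = totalBlockSum K F u v)
    (u v : List α) : opM K (u.map g) (v.map g) = F u v := by
  induction hn : u.length + v.length using Nat.strong_induction_on generalizing u v with
  | _ n ih =>
    match u, v with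
    | [], [] => rw [List.map_nil, opM, h00]
    | [x], [] => rw [List.map_nil, List.map_singleton, opM, h10]
    | [], [y] => rw [List.map_nil, List.map_singleton, opM, h01]
    | x :: x' :: u, [] => rw [hl _ (by simp)]; simp [opM]
    | [], y :: y' :: v => rw [hr _ (by simp)]; simp [opM]
    | x :: u, y :: v =>
      have h1 := dotProd_mul_dotProd (K := K) (u := (x :: u).map g) (v := (y :: v).map g)
        (by simp) (by simp)
      rw [hmul _ _ (by simp) (by simp), totalBlockSum_eq_add _ (by simp),
        totalBlockSum_eq_add _ (by simp)] at h1
      have h2 : ∑ k ∈ Finset.Icc 2 (((x :: u).map g).length + ((y :: v).map g).length),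
          blockProdSum K (opM K) k ((x :: u).map g) ((y :: v).map g) =
          ∑ k ∈ Finset.Icc 2 ((x :: u).length + (y :: v).length),
            blockProdSum K F k (x :: u) (y :: v) := by
        rw [List.length_map, List.length_map]
        refine Finset.sum_congr rfl fun k hk => ?_
        rw [blockProdSum_map]
        unfold blockProdSum
        congr 1
        refine List.map_congr_left fun π hπ => ?_
        congr 1
        refine List.map_congr_left fun b hb => ?_
        exact ih _ (hn ▸ length_lt_of_mem_blockings (Finset.mem_Icc.1 hk).1 hπ hb) _ _ rfl
      rw [h2] at h1
      exact (add_right_cancel h1).symm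

/-- Homomorphisms of 2-associative algebras preserve the operations. -/
theorem opM_map {B : Type*} [Ring B] [Algebra K B] [TwoAssociativeAlgebra K B] (φ : A →ₐ[K] B)
    (hφ : ∀ x y, φ (dot (K := K) x y) = dot (K := K) (φ x) (φ y)) (u v : List A) :
    opM K (u.map φ) (v.map φ) = φ (opM K u v) := by
  have hd : ∀ l : List A, dotProd K (l.map φ) = φ (dotProd K l) := by
    intro l
    induction l with
    | nil => simp
    | cons x l ih => simp [ih, hφ]
  refine opM_map_eq (K := K) φ (fun u v => φ (opM K u v)) ?_ ?_ ?_ ?_ ?_ ?_ u v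
  · simp [opM]
  · simp [opM]
  · simp [opM]
  · rintro (_ | ⟨x, _ | ⟨y, u⟩⟩) hu <;> simp [opM] at hu ⊢
  · rintro (_ | ⟨x, _ | ⟨y, u⟩⟩) hu <;> simp [opM] at hu ⊢
  · intro u v hu hv
    rw [hd, hd, ← map_mul, dotProd_mul_dotProd hu hv, totalBlockSum, totalBlockSum, map_sum]
    refine Finset.sum_congr rfl fun k _ => ?_
    simp only [blockProdSum, map_list_sum, List.map_map]
    congr 1
    refine List.map_congr_left fun π _ => ?_
    simp only [Function.comp_apply]
    rw [← hd, List.map_map]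
    rfl

end BlockProdSum

/-! ### The operations on primitive elements -/

section PrimOp

variable {K A : Type*} [Field K] [Ring A] [Algebra K A] [Coalgebra K A]
  [TwoAssociativeAlgebra K A]


theorem dotLift_subtype_word (l : List (Prim K A)) :
    dotLift (Prim K A).subtype (TensorCoalgebra.word K (Prim K A) l) =
      dotProd K (l.map Subtype.val) := dotLift_word _ l

theorem comul_dotProd (h : IsTwoAssociativeBialgebra K A) (l : List (Prim K A)) :
    Coalgebra.comul (R := K) (dotProd K (l.map Subtype.val) : A) =
      ∑ i ∈ Finset.range (l.length + 1), dotProd K ((l.take i).map Subtype.val) ⊗ₜ[K]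
        dotProd K ((l.drop i).map Subtype.val) := by
  have h1 := CoalgHomClass.map_comp_comul_apply (dotLiftHom h (Prim K A).subtype subtype_mem_Prim)
    (TensorCoalgebra.word K (Prim K A) l)
  have h2 : Coalgebra.comul (R := K) (TensorCoalgebra.word K (Prim K A) l) = _ :=
    TensorCoalgebra.comul_word K _ l
  rw [h2, map_sum, dotLiftHom_apply, dotLift_subtype_word] at h1
  rw [← h1]
  refine Finset.sum_congr rfl fun i _ => ?_
  rw [TensorProduct.map_tmul, ← dotLift_subtype_word, ← dotLift_subtype_word]
  rfl

theorem counit_dotProd (h : IsTwoAssociativeBialgebra K A) (l : List (Prim K A)) :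
    Coalgebra.counit (R := K) (dotProd K (l.map Subtype.val) : A) = if l = [] then 1 else 0 := by
  rw [← dotLift_subtype_word, ← dotLiftHom_apply h _ subtype_mem_Prim,
    CoalgHomClass.counit_comp_apply]
  exact TensorCoalgebra.counit_word K _ l

/-- The operation `M(u, v)` on primitive elements: the component of `(u₁ · … · u_p) * (v₁ · … · v_q)`
on words of length one, where `e` is the projection of words onto letters. -/
def primOp (e : A →ₗ[K] Prim K A) (u v : List (Prim K A)) : Prim K A :=
  e (dotProd K (u.map Subtype.val) * dotProd K (v.map Subtype.val))

variable {e : A →ₗ[K] Prim K A}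

theorem apply_dotProd_eq_zero
    (he : ∀ y, e (dotLift (Prim K A).subtype y) = TensorCoalgebra.letter y)
    {l : List (Prim K A)} (hl : l.length ≠ 1) : e (dotProd K (l.map Subtype.val)) = 0 := by
  rw [← dotLift_subtype_word, he]
  match l, hl with
  | [], _ => exact TensorCoalgebra.letter_one
  | v :: w :: l, _ => exact TensorCoalgebra.letter_word _ (by simp)

theorem apply_primitive
    (he : ∀ y, e (dotLift (Prim K A).subtype y) = TensorCoalgebra.letter y) (x : Prim K A) :
    e x = x := by
  simpa using he (TensorAlgebra.ι K x)

theorem primOp_nil_nil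
    (he : ∀ y, e (dotLift (Prim K A).subtype y) = TensorCoalgebra.letter y) :
    primOp e [] [] = 0 := by
  simpa [primOp] using apply_dotProd_eq_zero he (l := []) (by simp)

theorem primOp_singleton_nil
    (he : ∀ y, e (dotLift (Prim K A).subtype y) = TensorCoalgebra.letter y) (x : Prim K A) :
    primOp e [x] [] = x := by
  simp [primOp, dot_one, apply_primitive he]

theorem primOp_nil_singleton
    (he : ∀ y, e (dotLift (Prim K A).subtype y) = TensorCoalgebra.letter y) (x : Prim K A) :
    primOp e [] [x] = x := by
  simp [primOp, dot_one, apply_primitive he]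

theorem primOp_left_nil
    (he : ∀ y, e (dotLift (Prim K A).subtype y) = TensorCoalgebra.letter y)
    (u : List (Prim K A)) (hu : 2 ≤ u.length) : primOp e u [] = 0 := by
  rw [primOp, List.map_nil, dotProd_nil, mul_one, apply_dotProd_eq_zero he (by omega)]

theorem primOp_nil_right
    (he : ∀ y, e (dotLift (Prim K A).subtype y) = TensorCoalgebra.letter y)
    (u : List (Prim K A)) (hu : 2 ≤ u.length) : primOp e [] u = 0 := by
  rw [primOp, List.map_nil, dotProd_nil, one_mul, apply_dotProd_eq_zero he (by omega)]

theorem eq_convId_add_counit (h : IsTwoAssociativeBialgebra K A)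
    (hs : Function.Surjective (dotLift (K := K) (Prim K A).subtype))
    (he : ∀ y, e (dotLift (Prim K A).subtype y) = TensorCoalgebra.letter y) (x : A) :
    x = convId ((Prim K A).subtype ∘ₗ e) x + algebraMap K A (Coalgebra.counit (R := K) x) := by
  obtain ⟨y, rfl⟩ := hs x
  rw [convId_dotLift h he, ← dotLiftHom_apply h _ subtype_mem_Prim,
    CoalgHomClass.counit_comp_apply, sub_add_cancel]

/-- The product `*` of words is the sum, over all cuttings into pairs of blocks, of the words of the
values of `M` on the pairs. This is how a coalgebra map into a tensor coalgebra, here the product `*`,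
is recovered from its projection onto letters; the induction splits off
the first letter of the result, which comes from the first pair of blocks. -/
theorem dotProd_mul_dotProd_eq_totalBlockSum (h : IsTwoAssociativeBialgebra K A)
    (hs : Function.Surjective (dotLift (K := K) (Prim K A).subtype))
    (he : ∀ y, e (dotLift (Prim K A).subtype y) = TensorCoalgebra.letter y)
    (u v : List (Prim K A)) :
    dotProd K (u.map Subtype.val) * dotProd K (v.map Subtype.val) =
      totalBlockSum K (fun u v => (primOp e u v : A)) u v := by
  induction hn : u.length + v.length using Nat.strong_induction_on generalizing u v with
  | _ n ih =>
    by_cases h0 : u.length + v.length = 0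
    · obtain rfl : u = [] := List.eq_nil_of_length_eq_zero (by omega)
      obtain rfl : v = [] := List.eq_nil_of_length_eq_zero (by omega)
      simp [totalBlockSum]
    have hε : Coalgebra.counit (R := K)
        (dotProd K (u.map Subtype.val) * dotProd K (v.map Subtype.val) : A) = 0 := by
      rw [h.counit_mul, counit_dotProd h, counit_dotProd h]
      by_cases hu : u = []
      · rw [if_neg (c := v = []) (by rintro rfl; simp [hu] at h0), mul_zero]
      · rw [if_neg hu, zero_mul]
    rw [eq_convId_add_counit h hs he (dotProd K (u.map Subtype.val) * dotProd K (v.map Subtype.val)),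
      hε, map_zero, add_zero, convId_apply, h.comul_mul, comul_dotProd h, comul_dotProd h,
      Finset.sum_mul_sum, totalBlockSum_rec _ (by omega)]
    simp only [map_sum, Algebra.TensorProduct.tmul_mul_tmul, LinearMap.rTensor_tmul, lift.tmul]
    refine Finset.sum_congr rfl fun i hi => Finset.sum_congr rfl fun j hj => ?_
    rw [Finset.mem_range] at hi hj
    by_cases hij : i + j = 0
    · obtain ⟨rfl, rfl⟩ : i = 0 ∧ j = 0 := by omega
      have h1 := primOp_nil_nil he
      simp only [primOp, List.map_nil, dotProd_nil] at h1
      simp only [if_true, List.take_zero, List.map_nil, dotProd_nil, LinearMap.comp_apply, h1,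
        map_zero, LinearMap.zero_apply, add_zero]
    · rw [if_neg hij, ← ih _ _ _ _ rfl]
      · rfl
      · simp only [List.length_drop]; omega

theorem opM_map_val (h : IsTwoAssociativeBialgebra K A)
    (hs : Function.Surjective (dotLift (K := K) (Prim K A).subtype))
    (he : ∀ y, e (dotLift (Prim K A).subtype y) = TensorCoalgebra.letter y)
    (u v : List (Prim K A)) :
    opM K (u.map Subtype.val) (v.map Subtype.val) = (primOp e u v : A) := by
  refine opM_map_eq (K := K) Subtype.val (fun u v => (primOp e u v : A)) ?_ ?_ ?_ ?_ ?_ ?_ u v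
  · simp [primOp_nil_nil he]
  · simp [primOp_singleton_nil he]
  · simp [primOp_nil_singleton he]
  · exact fun u hu => by simp [primOp_left_nil he u hu]
  · exact fun u hu => by simp [primOp_nil_right he u hu]
  · exact fun u v _ _ => dotProd_mul_dotProd_eq_totalBlockSum h hs he u v

theorem blockSum_eq_sum {α B : Type*} [AddCommMonoid B] (f : List (List α × List α) → B)
    (u v : List α) : blockSum f u v =
      ∑ k ∈ Finset.Icc 1 (u.length + v.length), ((blockings k u v).map f).sum := rfl

/-- A linear map applied to the expansion of `(u₁ · … · u_p) * (v₁ · … · v_q)`. -/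
theorem apply_dotProd_mul_dotProd (h : IsTwoAssociativeBialgebra K A)
    (hs : Function.Surjective (dotLift (K := K) (Prim K A).subtype))
    (he : ∀ y, e (dotLift (Prim K A).subtype y) = TensorCoalgebra.letter y)
    (f : A →ₗ[K] Prim K A) {u v : List (Prim K A)} (hu : u ≠ []) :
    f (dotProd K (u.map Subtype.val) * dotProd K (v.map Subtype.val)) =
      blockSum (fun π => f (dotProd K ((π.map fun b => primOp e b.1 b.2).map Subtype.val))) u v := by
  have := List.length_pos_iff.2 hu
  rw [dotProd_mul_dotProd_eq_totalBlockSum h hs he, totalBlockSum_eq_sum_Icc_one _ (by omega),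
    blockSum_eq_sum, map_sum]
  refine Finset.sum_congr rfl fun k _ => ?_
  rw [blockProdSum, map_list_sum, List.map_map]
  congr 1
  refine List.map_congr_left fun π _ => ?_
  simp [Function.comp_def]

/-- The `B_∞`-structure on the primitive elements. Its associativity relations are the projection onto
letters of the associativity of `*`. -/
abbrev primBInfinityAlgebra (h : IsTwoAssociativeBialgebra K A)
    (hs : Function.Surjective (dotLift (K := K) (Prim K A).subtype))
    (he : ∀ y, e (dotLift (Prim K A).subtype y) = TensorCoalgebra.letter y) :
    BInfinityAlgebra K (Prim K A) where
  op := primOp e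
  op_add_left a b v x y := by simp [primOp, dotProd_append, add_mul]
  op_smul_left a b v c x := by simp [primOp, dotProd_append]
  op_add_right u a b x y := by simp [primOp, dotProd_append, mul_add]
  op_smul_right u a b c x := by simp [primOp, dotProd_append]
  op_nil_nil := primOp_nil_nil he
  op_singleton_nil := primOp_singleton_nil he
  op_nil_singleton := primOp_nil_singleton he
  op_left_nil := primOp_left_nil he
  op_nil_right := primOp_nil_right he
  op_rel u v w hu hv _ := by
    have h1 := apply_dotProd_mul_dotProd h hs he
      (e ∘ₗ LinearMap.mulRight K (dotProd K (w.map Subtype.val))) (v := v) hu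
    have h2 := apply_dotProd_mul_dotProd h hs he
      (e ∘ₗ LinearMap.mulLeft K (dotProd K (u.map Subtype.val))) (v := w) hv
    simp only [LinearMap.comp_apply, LinearMap.mulLeft_apply, LinearMap.mulRight_apply] at h1 h2
    rw [← mul_assoc] at h2
    exact h1.symm.trans h2

theorem exists_isSubBInfinity {K H : Type*} [Field K] [Ring H] [Bialgebra K H]
    [TwoAssociativeAlgebra K H] (h : IsTwoAssociativeBialgebra K H) (hc : IsConnected K H) :
    ∃ _ : BInfinityAlgebra K (Prim K H), IsSubBInfinity K H := by
  obtain ⟨e, he⟩ := exists_retraction h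
  have hs := dotLift_subtype_surjective h hc
  exact ⟨primBInfinityAlgebra h hs he, fun u v => (opM_map_val h hs he u v).symm⟩

end PrimOp

/-! ### The enveloping 2-associative algebra of a `B_∞`-algebra -/

namespace FreeTwoAssociative

variable {K V A : Type*} [CommRing K] [AddCommGroup V] [Module K V] [Ring A] [Algebra K A]
  [TwoAssociativeAlgebra K A]

/-- Evaluation of terms in a 2-associative algebra. -/
def Pre.eval (g : V →ₗ[K] A) : Pre K V → A
  | .of v => g v
  | .scalar c => algebraMap K A c
  | .add a b => a.eval g + b.eval g
  | .mul a b => a.eval g * b.eval g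
  | .dot a b => TwoAssociativeAlgebra.dot (K := K) (a.eval g) (b.eval g)

theorem Pre.eval_eq_of_rel (g : V →ₗ[K] A) {a b : Pre K V} (h : Rel K V a b) :
    a.eval g = b.eval g := by
  induction h with
  | scalar_central c a => exact Algebra.commutes c _
  | mul_assoc a b c => exact _root_.mul_assoc _ _ _
  | add_assoc a b c => exact _root_.add_assoc _ _ _
  | add_comm a b => exact _root_.add_comm _ _
  | dot_assoc a b c => exact TwoAssociativeAlgebra.dot_assoc (K := K) _ _ _
  | _ => simp_all [Pre.eval, mul_add, add_mul, TwoAssociativeAlgebra.one_dot,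
      TwoAssociativeAlgebra.dot_one, ← Algebra.smul_def]

/-- The homomorphism of 2-associative algebras `2as(V) → A` that extends a linear map `V → A`. -/
def lift (g : V →ₗ[K] A) : FreeTwoAssociative K V →ₐ[K] A where
  toFun := Quot.lift (Pre.eval g) fun _ _ => Pre.eval_eq_of_rel g
  map_one' := map_one (algebraMap K A)
  map_mul' := by rintro ⟨a⟩ ⟨b⟩; rfl
  map_zero' := map_zero (algebraMap K A)
  map_add' := by rintro ⟨a⟩ ⟨b⟩; rfl
  commutes' _ := rfl

theorem lift_ι (g : V →ₗ[K] A) (v : V) : lift g (ι K V v) = g v := rfl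

theorem lift_dot (g : V →ₗ[K] A) (x y : FreeTwoAssociative K V) :
    lift g (dot (K := K) x y) = dot (K := K) (lift g x) (lift g y) := by
  obtain ⟨a⟩ := x
  obtain ⟨b⟩ := y
  rfl

end FreeTwoAssociative

namespace U2

variable {K R A : Type*} [CommRing K] [AddCommGroup R] [Module K R] [BInfinityAlgebra K R]

theorem mk_dot (x y : FreeTwoAssociative K R) :
    mk K R (dot (K := K) x y) = dot (K := K) (mk K R x) (mk K R y) := rfl

theorem opM_map_ι (u v : List R) :
    opM K (u.map (ι K R)) (v.map (ι K R)) = ι K R (BInfinityAlgebra.op K u v) := by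
  have h1 := opM_map (mk K R) mk_dot (u.map (FreeTwoAssociative.ι K R))
    (v.map (FreeTwoAssociative.ι K R))
  have h2 : mk K R (FreeTwoAssociative.ι K R (BInfinityAlgebra.op K u v)) = mk K R
      (opM K (u.map (FreeTwoAssociative.ι K R)) (v.map (FreeTwoAssociative.ι K R))) := by
    rw [mk_eq_mk, relIdeal, twoIdealSpan, TwoSidedIdeal.mem_sInf]
    exact fun I hI => hI.1 ⟨u, v, rfl⟩
  rw [List.map_map, List.map_map] at h1
  exact h1.trans h2.symm

variable [Ring A] [Algebra K A] [TwoAssociativeAlgebra K A]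

theorem relIdeal_le_ker (g : R →ₗ[K] A)
    (hg : ∀ u v, opM K (u.map g) (v.map g) = g (BInfinityAlgebra.op K u v)) :
    relIdeal K R ≤ TwoSidedIdeal.ker (FreeTwoAssociative.lift (K := K) g) := by
  refine sInf_le ⟨?_, fun a x hx => ?_⟩
  · rintro _ ⟨u, v, rfl⟩
    have h1 := opM_map (FreeTwoAssociative.lift (K := K) g) (FreeTwoAssociative.lift_dot g)
      (u.map (FreeTwoAssociative.ι K R)) (v.map (FreeTwoAssociative.ι K R))
    rw [List.map_map, List.map_map] at h1
    rw [SetLike.mem_coe, TwoSidedIdeal.mem_ker, map_sub, ← h1, FreeTwoAssociative.lift_ι, ← hg,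
      sub_eq_zero]
    rfl
  · rw [TwoSidedIdeal.mem_ker] at hx ⊢
    rw [TwoSidedIdeal.mem_ker, FreeTwoAssociative.lift_dot, FreeTwoAssociative.lift_dot, hx]
    simp

/-- The homomorphism of 2-associative algebras `U2(R) → A` that extends a linear map `g : R → A`
compatible with the operations `M`. -/
def lift (g : R →ₗ[K] A)
    (hg : ∀ u v, opM K (u.map g) (v.map g) = g (BInfinityAlgebra.op K u v)) : U2 K R →ₐ[K] A where
  toFun := Quotient.lift (FreeTwoAssociative.lift (K := K) g) fun x y hxy => by
    have h1 : x - y ∈ relIdeal K R := (mk_eq_mk K R x y).1 (Quotient.sound hxy)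
    have h2 := relIdeal_le_ker g hg h1
    rwa [TwoSidedIdeal.mem_ker, map_sub, sub_eq_zero] at h2
  map_one' := map_one (FreeTwoAssociative.lift (K := K) g)
  map_mul' := by
    rintro ⟨a⟩ ⟨b⟩
    exact map_mul (FreeTwoAssociative.lift (K := K) g) a b
  map_zero' := map_zero (FreeTwoAssociative.lift (K := K) g)
  map_add' := by
    rintro ⟨a⟩ ⟨b⟩
    exact map_add (FreeTwoAssociative.lift (K := K) g) a b
  commutes' _ := rfl

theorem lift_ι (g : R →ₗ[K] A)
    (hg : ∀ u v, opM K (u.map g) (v.map g) = g (BInfinityAlgebra.op K u v)) (r : R) :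
    lift g hg (ι K R r) = g r := rfl

theorem lift_dot (g : R →ₗ[K] A)
    (hg : ∀ u v, opM K (u.map g) (v.map g) = g (BInfinityAlgebra.op K u v)) (x y : U2 K R) :
    lift g hg (dot (K := K) x y) = dot (K := K) (lift g hg x) (lift g hg y) := by
  obtain ⟨a, rfl⟩ := mk_surjective K R x
  obtain ⟨b, rfl⟩ := mk_surjective K R y
  exact FreeTwoAssociative.lift_dot g a b

theorem lift_dotLift (g : R →ₗ[K] A)
    (hg : ∀ u v, opM K (u.map g) (v.map g) = g (BInfinityAlgebra.op K u v))
    (x : TensorCoalgebra K R) : lift g hg (dotLift (ι K R) x) = dotLift g x := by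
  induction x using TensorCoalgebra.induction_left with
  | h1 => rw [dotLift_one, dotLift_one, map_one]
  | hsmul c x hx => simp only [map_smul, hx]
  | hadd x y hx hy => simp only [map_add, hx, hy]
  | hmul v x hx => rw [dotLift_ι_mul, dotLift_ι_mul, lift_dot, hx, lift_ι]

end U2

namespace U2

variable {K R : Type*} [Field K] [AddCommGroup R] [Module K R] [BInfinityAlgebra K R]

/-- In `U2(R)`, the defining relations turn a product `*` of two words into a sum of words. -/
theorem dotProd_mul_dotProd_mem (u v : List R) :
    dotProd K (u.map (ι K R)) * dotProd K (v.map (ι K R)) ∈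
      LinearMap.range (dotLift (K := K) (ι K R)) := by
  have hw : ∀ l : List R, dotProd K (l.map (ι K R)) ∈ LinearMap.range (dotLift (K := K) (ι K R)) :=
    fun l => ⟨_, dotLift_word _ l⟩
  by_cases hu : u = []
  · subst hu
    simpa using hw v
  by_cases hv : v = []
  · subst hv
    simpa using hw u
  rw [dotProd_mul_dotProd (by simpa using hu) (by simpa using hv), totalBlockSum]
  refine sum_mem fun k _ => ?_
  rw [blockProdSum_map, blockProdSum]
  refine list_sum_mem fun y hy => ?_
  obtain ⟨π, _, rfl⟩ := List.mem_map.1 hy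
  simp only [opM_map_ι]
  have := hw (π.map fun b => BInfinityAlgebra.op K b.1 b.2)
  rwa [List.map_map] at this

theorem dotLift_ι_surjective : Function.Surjective (dotLift (K := K) (ι K R)) := by
  rw [← LinearMap.range_eq_top, eq_top_iff]
  rintro x -
  induction x using induction with
  | hι r => exact ⟨TensorAlgebra.ι K r, dotLift_ι _ r⟩
  | hscalar c => exact ⟨c • 1, by rw [map_smul, dotLift_one, Algebra.algebraMap_eq_smul_one]⟩
  | hadd x y hx hy => exact add_mem hx hy
  | hdot x y hx hy =>
    obtain ⟨a, rfl⟩ := hx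
    obtain ⟨b, rfl⟩ := hy
    exact ⟨a * b, dotLift_mul _ a b⟩
  | hmul x y hx hy =>
    obtain ⟨a, rfl⟩ := hx
    obtain ⟨b, rfl⟩ := hy
    have ha : a ∈ Submodule.span K (Set.range (TensorCoalgebra.word K R)) := by
      rw [TensorCoalgebra.span_range_word]; trivial
    have hb : b ∈ Submodule.span K (Set.range (TensorCoalgebra.word K R)) := by
      rw [TensorCoalgebra.span_range_word]; trivial
    induction ha, hb using Submodule.span_induction₂ with
    | mem_mem x y hx hy =>
      obtain ⟨u, rfl⟩ := hx
      obtain ⟨v, rfl⟩ := hy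
      rw [dotLift_word, dotLift_word]
      exact dotProd_mul_dotProd_mem u v
    | zero_left y hy => simp
    | zero_right x hx => simp
    | add_left x y z _ _ _ h1 h2 => rw [map_add, add_mul]; exact add_mem h1 h2
    | add_right x y z _ _ _ h1 h2 => rw [map_add, mul_add]; exact add_mem h1 h2
    | smul_left r x y _ _ h1 => rw [map_smul, smul_mul_assoc]; exact Submodule.smul_mem _ r h1
    | smul_right r x y _ _ h1 => rw [map_smul, mul_smul_comm]; exact Submodule.smul_mem _ r h1

end U2

/-! ### Reconstruction from the primitive elements -/

section Transport

variable {K A B : Type*} [Field K] [Ring A] [Algebra K A] [Coalgebra K A]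
  [TwoAssociativeAlgebra K A] [Ring B] [Algebra K B] [TwoAssociativeAlgebra K B]

/-- Transport of the coproduct along an isomorphism of 2-associative algebras. -/
theorem IsTwoAssociativeBialgebra.exists_transport (h : IsTwoAssociativeBialgebra K A)
    (E : A ≃ₐ[K] B) (hE : ∀ x y, E (dot (K := K) x y) = dot (K := K) (E x) (E y)) :
    ∃ _ : Coalgebra K B, IsTwoAssociativeBialgebra K B ∧ (∀ x ∈ Prim K A, E x ∈ Prim K B) ∧
      Nonempty (TwoAssociativeBialgebraIso K A B) := by
  let s : CoalgebraStruct K B :=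
    { comul := TensorProduct.map E.toLinearMap E.toLinearMap ∘ₗ Coalgebra.comul ∘ₗ
        E.symm.toLinearMap
      counit := Coalgebra.counit ∘ₗ E.symm.toLinearMap }
  let F : A ≃ₗc[K] B :=
    { E.toLinearEquiv with
      counit_comp := by
        ext x
        change Coalgebra.counit (R := K) (E.symm (E x)) = _
        rw [E.symm_apply_apply]
      map_comp_comul := by
        ext1 x
        change _ = TensorProduct.map E.toLinearMap E.toLinearMap
          (Coalgebra.comul (R := K) (E.symm (E x)))
        rw [E.symm_apply_apply]
        rfl }
  let c : Coalgebra K B := F.toCoalgebra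
  have hΔ : ∀ x, Coalgebra.comul (R := K) (E x) =
      TensorProduct.map E.toLinearMap E.toLinearMap (Coalgebra.comul (R := K) x) :=
    fun x => (LinearMap.congr_fun F.map_comp_comul x).symm
  have hε : ∀ x, Coalgebra.counit (R := K) (E x) = Coalgebra.counit (R := K) x :=
    fun x => LinearMap.congr_fun F.counit_comp x
  have hmul : ∀ s t : A ⊗[K] A, TensorProduct.map E.toLinearMap E.toLinearMap (s * t) =
      TensorProduct.map E.toLinearMap E.toLinearMap s *
        TensorProduct.map E.toLinearMap E.toLinearMap t := fun s t =>
    map_mul (Algebra.TensorProduct.map (E : A →ₐ[K] B) (E : A →ₐ[K] B)) s t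
  have hdot : ∀ s t : A ⊗[K] A, TensorProduct.map E.toLinearMap E.toLinearMap
      (map₂ (dot (K := K)) (dot (K := K)) s t) = map₂ (dot (K := K)) (dot (K := K))
        (TensorProduct.map E.toLinearMap E.toLinearMap s)
        (TensorProduct.map E.toLinearMap E.toLinearMap t) := by
    intro s t
    induction s using TensorProduct.induction_on with
    | zero => simp
    | add s s' hs hs' => simp only [map_add, LinearMap.add_apply, hs, hs']
    | tmul a b =>
      induction t using TensorProduct.induction_on with
      | zero => simp
      | add t t' ht ht' => simp only [map_add, ht, ht']
      | tmul a' b' => simp [hE]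
  refine ⟨c, ⟨?_, ?_, ?_, ?_, ?_⟩, ?_, ⟨{ F with
    map_one' := map_one E
    map_mul' := map_mul E
    map_dot' := hE }⟩⟩
  · rw [← map_one E, hε, h.counit_one]
  · intro x y
    obtain ⟨x, rfl⟩ := E.surjective x
    obtain ⟨y, rfl⟩ := E.surjective y
    rw [← map_mul, hε, hε, hε, h.counit_mul]
  · rw [← map_one E, hΔ, h.comul_one]
    simp
  · intro x y
    obtain ⟨x, rfl⟩ := E.surjective x
    obtain ⟨y, rfl⟩ := E.surjective y
    rw [← map_mul, hΔ, hΔ, hΔ, h.comul_mul, hmul]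
  · intro x y
    obtain ⟨x, rfl⟩ := E.surjective x
    obtain ⟨y, rfl⟩ := E.surjective y
    rw [← hE, hΔ, hΔ, hΔ, h.comul_dot, map_sub, map_add, hdot, hdot]
    simp
  · intro x hx
    rw [mem_Prim, hΔ, mem_Prim.1 hx]
    simp

end Transport

section Main

variable {K H : Type*} [Field K] [Ring H] [Bialgebra K H] [TwoAssociativeAlgebra K H]

theorem isIsoU2Prim_of_isConnected (h : IsTwoAssociativeBialgebra K H) (hc : IsConnected K H) :
    IsIsoU2Prim K H := by
  obtain ⟨b, hb⟩ := exists_isSubBInfinity h hc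
  have hθ := dotLift_subtype_bijective h hc
  have hg : ∀ u v, opM K (u.map (Prim K H).subtype) (v.map (Prim K H).subtype) =
      (Prim K H).subtype (BInfinityAlgebra.op K u v) := fun u v => (hb u v).symm
  have hbij : Function.Bijective (U2.lift (Prim K H).subtype hg) := by
    have hcomp : ⇑(U2.lift (Prim K H).subtype hg) ∘ ⇑(dotLift (U2.ι K (Prim K H))) =
        dotLift (Prim K H).subtype := funext (U2.lift_dotLift _ hg)
    rw [← hcomp] at hθ
    exact ⟨fun x y hxy => by
      obtain ⟨a, rfl⟩ := U2.dotLift_ι_surjective x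
      obtain ⟨b, rfl⟩ := U2.dotLift_ι_surjective y
      exact congrArg _ (hθ.1 hxy), hθ.2.of_comp⟩
  let E := AlgEquiv.ofBijective _ hbij
  have hE : ∀ x y, E.symm (dot (K := K) x y) = dot (K := K) (E.symm x) (E.symm y) := by
    intro x y
    apply E.injective
    rw [E.apply_symm_apply]
    refine Eq.trans ?_ (U2.lift_dot _ hg _ _).symm
    exact congrArg₂ (fun x y => dot (K := K) x y) (E.apply_symm_apply x).symm
      (E.apply_symm_apply y).symm
  obtain ⟨c, hU, hp, hI⟩ := h.exists_transport E.symm hE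
  refine ⟨b, hb, c, hU, fun r => ?_, hI⟩
  have h1 : E.symm r = U2.ι K (Prim K H) r := E.symm_apply_apply (U2.ι K (Prim K H) r)
  rw [← h1]
  exact hp r r.2

theorem IsIsoU2Prim.isConnected (h : IsIsoU2Prim K H) : IsConnected K H := by
  obtain ⟨b, hb, c, hU, hp, ⟨I⟩⟩ := h
  have h1 : IsConnected K (U2 K (Prim K H)) := IsConnected.of_surjective
    (dotLiftHom hU (U2.ι K (Prim K H)) hp) (dotLift_one _) U2.dotLift_ι_surjective
    TensorCoalgebra.isConnected
  refine IsConnected.of_surjective (I.toCoalgEquiv.symm : U2 K (Prim K H) →ₗc[K] H) ?_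
    I.toCoalgEquiv.symm.surjective h1
  have h2 : I.toCoalgEquiv 1 = 1 := I.map_one'
  rw [← h2]
  exact I.toCoalgEquiv.symm_apply_apply 1

theorem isCofree_of_isConnected (h : IsTwoAssociativeBialgebra K H) (hc : IsConnected K H) :
    IsCofree K H := exists_coalgEquiv h hc

theorem tfae_of_isTwoAssociativeBialgebra (h : IsTwoAssociativeBialgebra K H) :
    List.TFAE [IsConnected K H, IsIsoU2Prim K H, IsCofree K H] := by
  tfae_have 1 → 2 := isIsoU2Prim_of_isConnected h
  tfae_have 2 → 1 := IsIsoU2Prim.isConnected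
  tfae_have 1 → 3 := isCofree_of_isConnected h
  tfae_have 3 → 1 := IsCofree.isConnected
  tfae_finish

end Main

end LodayRonco

theorem theorem4p1 (K H : Type*) [Field K] [Ring H] [Bialgebra K H] :
    List.TFAE [
      ∃ _ : LodayRonco.TwoAssociativeAlgebra K H,
        LodayRonco.IsTwoAssociativeBialgebra K H ∧ LodayRonco.IsConnected K H,
      ∃ _ : LodayRonco.TwoAssociativeAlgebra K H,
        LodayRonco.IsTwoAssociativeBialgebra K H ∧ LodayRonco.IsIsoU2Prim K H,
      LodayRonco.IsCofree K H] ∧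
    ∀ _ : LodayRonco.TwoAssociativeAlgebra K H, LodayRonco.IsTwoAssociativeBialgebra K H →
      List.TFAE [
        LodayRonco.IsConnected K H,
        LodayRonco.IsIsoU2Prim K H,
        LodayRonco.IsCofree K H] := by
  refine ⟨?_, fun _ h => LodayRonco.tfae_of_isTwoAssociativeBialgebra h⟩
  tfae_have 1 → 2 := fun ⟨T, h, hc⟩ => ⟨T, h, LodayRonco.isIsoU2Prim_of_isConnected h hc⟩
  tfae_have 2 → 1 := fun ⟨T, h, hI⟩ => ⟨T, h, hI.isConnected⟩
  tfae_have 1 → 3 := fun ⟨_, h, hc⟩ => LodayRonco.isCofree_of_isConnected h hc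
  tfae_have 3 → 1 := fun h =>
    let ⟨T, hT⟩ := h.exists_isTwoAssociativeBialgebra
    ⟨T, hT, h.isConnected⟩
  tfae_finish
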